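/- For $w\in\mathbb{R}^m$ and $\alpha\ge 0$ let $\|w\|^{(\alpha)}=\max\{\|w\|_2,\alpha\|w\|_\infty\}$ be the clipped $\ell_2$-norm. A matrix $B\in\mathbb{R}^{m\times N}$ has the $\ell_1$-quotient property with constant $d$ relative to a norm $\|\cdot\|$ on $\mathbb{R}^m$ if for every $w\in\mathbb{R}^m$ there is $u\in\mathbb{R}^N$ with $Bu=w$ and $\|u\|_1\le d\, s_*^{1/2}\|w\|$, where $s_*=m/\log(eN/m)$. Let $X$ be a real random variable with mean $0$ and variance $1$. It is super-Gaussian with parameter $\sigma>0$ if $\mathbb{P}(|\sigma g|>t)\le\mathbb{P}(|X|>t)$ for all $t>0$, where $g$ is a standard normal variable. It fulfills the weak moment assumption of order $k$ with constants $\kappa_1>0$ and $\gamma\ge 1/2$ if $(\mathbb{E}|X|^p)^{1/p}\le\kappa_1p^\gamma$ for all real $p$ with $4\le p\le k$. **Theorem.** Below, $m,N\ge 1$ are integers and $A=(a_{ji})$ is an $m\times N$ random matrix whose entries are independent and all distributed as a symmetric random variable $X$ of unit variance. (a) There is an absolute constant $c_0>0$ such that for all $\kappa_1>0$ and $\gamma\ge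 1/2$ there are constants $\widetilde C,D>0$, depending only on $\kappa_1$ and $\gamma$, with the following property. If $X$ fulfills the weak moment assumption of order $\max\{4,\log m\}$ with constants $\kappa_1$ and $\gamma$, if $4e^{4\gamma}c_0^2\kappa_1^2\log m\le m$, and if $N\ge\max\{\widetilde Cm,(\log m)^{2\gamma-1}\}$, then with probability at least $1-2e^{-2m}$ the matrix $\frac{1}{\sqrt m}A$ has the $\ell_1$-quotient property with constant $D$ relative to the clipped norm $\|\cdot\|^{(\alpha)}$ with $\alpha=\sqrt{\log(eN/m)}$. (b) For every $0<\sigma\le 1$ there are constants $\widetilde C,D>0$, depending only on $\sigma$, with the following property. If $X$ is super-Gaussian with parameter $\sigma$ and $N\ge\widetilde Cm$, then with probability at least $1-2e^{-2m}$ the matrix $\frac{1}{\sqrt m}A$ has the $\ell_1$-quotient property with constant $D$ relative to the $\ell_2$-norm. -/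

import Mathlib

open MeasureTheory ProbabilityTheory

/-- The Euclidean norm of `w ∈ ℝ^m`. -/
noncomputable def l2Norm {m : ℕ} (w : Fin m → ℝ) : ℝ :=
  ‖WithLp.toLp 2 w‖

/-- The clipped `ℓ₂`-norm `max {‖w‖₂, α ‖w‖_∞}` with parameter `α`
(the norm of `Fin m → ℝ` is the supremum norm). -/
noncomputable def clippedNorm {m : ℕ} (α : ℝ) (w : Fin m → ℝ) : ℝ :=
  max (l2Norm w) (α * ‖w‖)

/-- The quantity `s_* = m / log (e N / m)`. -/
noncomputable def sStar (m N : ℕ) : ℝ :=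
  (m : ℝ) / Real.log (Real.exp 1 * N / m)

/-- The `ℓ₁`-quotient property with constant `d` relative to the norm `nrm` on `ℝ^m`. -/
def HasL1QuotientProperty {m N : ℕ} (B : Matrix (Fin m) (Fin N) ℝ) (d : ℝ)
    (nrm : (Fin m → ℝ) → ℝ) : Prop :=
  ∀ w : Fin m → ℝ, ∃ u : Fin N → ℝ,
    B.mulVec u = w ∧ ∑ i, |u i| ≤ d * Real.sqrt (sStar m N) * nrm w

/-- A centered random variable `X` of unit variance is super-Gaussian with parameter `σ`
if `ℙ(|σ g| > t) ≤ ℙ(|X| > t)` for all `t > 0`, where `g` is standard normal. -/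
structure IsSuperGaussian {Ω : Type*} [MeasurableSpace Ω] (X : Ω → ℝ) (P : Measure Ω)
    (σ : ℝ) : Prop where
  mean_zero : ∫ ω, X ω ∂P = 0
  variance_one : variance X P = 1
  tail : ∀ t : ℝ, 0 < t →
    gaussianReal 0 1 {x : ℝ | t < |σ * x|} ≤ P {ω | t < |X ω|}

/-- A centered random variable `X` of unit variance fulfills the weak moment assumption of order
`k` with constants `κ` and `γ` if `‖X‖_{L_p} ≤ κ p^γ` for all real `4 ≤ p ≤ k`. -/
structure WeakMomentAssumption {Ω : Type*} [MeasurableSpace Ω] (X : Ω → ℝ) (P : Measure Ω)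
    (k κ γ : ℝ) : Prop where
  mean_zero : ∫ ω, X ω ∂P = 0
  variance_one : variance X P = 1
  moment : ∀ p : ℝ, 4 ≤ p → p ≤ k →
    eLpNorm X (ENNReal.ofReal p) P ≤ ENNReal.ofReal (κ * p ^ γ)

/-- `A` is a random matrix whose entries are independent and all distributed as the symmetric
random variable `X` of unit variance. -/
structure IsIIDSymmetricUnitVariance {Ω Ω' : Type*} [MeasurableSpace Ω] [MeasurableSpace Ω']
    {m N : ℕ} (A : Ω → Matrix (Fin m) (Fin N) ℝ) (μ : Measure Ω)
    (X : Ω' → ℝ) (P : Measure Ω') : Prop where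
  indep : iIndepFun (fun (p : Fin m × Fin N) (ω : Ω) => A ω p.1 p.2) μ
  identDistrib : ∀ (j : Fin m) (i : Fin N), IdentDistrib (fun ω => A ω j i) X μ P
  symmetric : IdentDistrib X (fun ω => -X ω) P P
  variance_one : variance X P = 1

/-!
The proof goes by duality. By Hahn–Banach, the quotient property fails only if some `w` and `v`
have `⟨w, v⟩` large while `|⟨A_i, v⟩| ≤ 1` for every column `A_i` of `A`; after rescaling, `w`
satisfies `‖w‖₂² ≤ τ` and, for the clipped norm, `‖w‖_∞ ≤ 1`, where `τ` is a small multiple of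
`log (e N / m)`. Two facts rule this out with high probability.

*A small-ball bound for one column* (`small_ball`). If `x` has independent symmetric entries, then
`⟨x, v⟩ ≥ c ⟨w, v⟩` with probability at least `exp (-C τ)`, hence at least `(m / (e N))^{1/2}`. The
coordinates with `|w_j| ≤ 1` are packed greedily into `τ` bins on each of which `w` has bounded
`ℓ₂`-norm (`exists_packing`); by Cauchy–Schwarz it is enough that each bin sum of `v_j x_j` exceeds
a multiple of the `ℓ₂`-norm of `v` on that bin, which happens with probability bounded below by
Paley–Zygmund for truncated entries (`block_small_ball`). Coordinates with `|w_j| > 1`, which occur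
only for the Euclidean norm, are treated one at a time with the Gaussian lower bound for the tail.

*A union bound over vertices* (`measure_exists_large_le`). For fixed `A`, a linear functional
`⟨w, ·⟩` on the polytope `{v | |⟨A_i, v⟩| ≤ 1}` is maximal at a vertex, and a vertex is determined
by `m` active constraints. It is therefore independent of the at least `N - m` other columns, each
of which satisfies its constraint at that vertex with probability at most `1 - (m / (e N))^{1/2}`.
The number of vertices is at most `(2 (N + m)).choose m`, and
`(2 (N + m)).choose m * (1 - (m / (e N))^{1/2}) ^ (N - m) ≤ exp (-2 m)` once `N / m` is large
(`choose_mul_pow_le`).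

The entries enter the small-ball bound through a lower bound for their truncated second moment. In
the first part it comes from the fourth moment (`half_le_truncated_second_moment`), in the second
from the Gaussian tail and Chebyshev's inequality (`truncated_second_moment_of_tail`).
-/

/-! ### Bin packing -/

/-- Greedy bin packing: weights in `[0, 1]` of total at most `τ` fit into `τ` bins of capacity `2`,
since some bin always has load at most `1`. -/
lemma exists_packing {ι : Type*} [DecidableEq ι] (s : Finset ι) (x : ι → ℝ) {τ : ℕ} (hτ : 0 < τ)
    (hx0 : ∀ j ∈ s, 0 ≤ x j) (hx1 : ∀ j ∈ s, x j ≤ 1) (hsum : ∑ j ∈ s, x j ≤ τ) :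
    ∃ f : ι → Fin τ, ∀ k, ∑ j ∈ s with f j = k, x j ≤ 2 := by
  induction s using Finset.induction_on with
  | empty => exact ⟨fun _ => ⟨0, hτ⟩, fun k => by simp⟩
  | insert a s ha ih =>
    have hsum' : x a + ∑ j ∈ s, x j ≤ τ := by rwa [Finset.sum_insert ha] at hsum
    have ha0 := hx0 a (Finset.mem_insert_self a s)
    have ha1 := hx1 a (Finset.mem_insert_self a s)
    obtain ⟨f, hf⟩ := ih (fun j hj => hx0 j (Finset.mem_insert_of_mem hj))
      (fun j hj => hx1 j (Finset.mem_insert_of_mem hj)) (by linarith)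
    obtain ⟨k, hk⟩ : ∃ k, ∑ j ∈ s with f j = k, x j ≤ 1 := by
      by_contra! h
      have h1 : ∑ k : Fin τ, (1 : ℝ) < ∑ k : Fin τ, ∑ j ∈ s with f j = k, x j :=
        Finset.sum_lt_sum_of_nonempty ⟨⟨0, hτ⟩, Finset.mem_univ _⟩ fun k _ => h k
      rw [Finset.sum_fiberwise] at h1
      simp at h1
      linarith
    refine ⟨Function.update f a k, fun l => ?_⟩
    have hfil : (s.filter fun j => Function.update f a k j = l) = s.filter fun j => f j = l := by
      refine Finset.filter_congr fun j hj => ?_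
      rw [Function.update_of_ne (by rintro rfl; exact ha hj)]
    rw [Finset.filter_insert, hfil]
    by_cases hl : Function.update f a k a = l
    · rw [if_pos hl, Finset.sum_insert (by simp [ha])]
      rw [Function.update_self] at hl
      subst hl
      linarith
    · rw [if_neg hl]
      exact hf l

/-! ### Moments of sums of independent variables -/

section Moments

variable {Ω : Type*} [MeasurableSpace Ω] {μ : Measure Ω} [IsProbabilityMeasure μ]

lemma integrable_pow_of_abs_le {S : Ω → ℝ} (hS : Measurable S) {C : ℝ} (hC : ∀ ω, |S ω| ≤ C)
    (n : ℕ) : Integrable (fun ω => S ω ^ n) μ :=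
  Integrable.of_bound (hS.pow_const n).aestronglyMeasurable (C ^ n)
    (.of_forall fun ω => by
      rw [Real.norm_eq_abs, abs_pow]; exact pow_le_pow_left₀ (abs_nonneg _) (hC ω) n)

lemma moments_add_of_indepFun {S Z : Ω → ℝ} (hS : Measurable S) (hZ : Measurable Z)
    (hind : IndepFun S Z μ) {C K : ℝ} (hC : ∀ ω, |S ω| ≤ C) (hK : ∀ ω, |Z ω| ≤ K)
    (hS0 : ∫ ω, S ω ∂μ = 0) (hZ0 : ∫ ω, Z ω ∂μ = 0) :
    ∫ ω, (S ω + Z ω) ^ 2 ∂μ = ∫ ω, S ω ^ 2 ∂μ + ∫ ω, Z ω ^ 2 ∂μ ∧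
    ∫ ω, (S ω + Z ω) ^ 4 ∂μ = ∫ ω, S ω ^ 4 ∂μ
      + 6 * ((∫ ω, S ω ^ 2 ∂μ) * ∫ ω, Z ω ^ 2 ∂μ) + ∫ ω, Z ω ^ 4 ∂μ := by
  have iS := integrable_pow_of_abs_le (μ := μ) hS hC
  have iZ := integrable_pow_of_abs_le (μ := μ) hZ hK
  have key : ∀ k l : ℕ, Integrable (fun ω => S ω ^ k * Z ω ^ l) μ ∧
      ∫ ω, S ω ^ k * Z ω ^ l ∂μ = (∫ ω, S ω ^ k ∂μ) * ∫ ω, Z ω ^ l ∂μ := by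
    intro k l
    have h := hind.comp (φ := fun x : ℝ => x ^ k) (ψ := fun x : ℝ => x ^ l)
      (measurable_id.pow_const k) (measurable_id.pow_const l)
    exact ⟨h.integrable_mul (iS k) (iZ l),
      h.integral_mul_eq_mul_integral (iS k).aestronglyMeasurable (iZ l).aestronglyMeasurable⟩
  have h11 := key 1 1
  have h31 := key 3 1
  have h22 := key 2 2
  have h13 := key 1 3
  simp only [pow_one, hS0, hZ0, zero_mul, mul_zero] at h11 h31 h13
  constructor
  · have : ∀ ω, (S ω + Z ω) ^ 2 = S ω ^ 2 + 2 * (S ω * Z ω) + Z ω ^ 2 := fun ω => by ring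
    simp_rw [this]
    rw [integral_add ((iS 2).fun_add (h11.1.const_mul 2)) (iZ 2),
      integral_add (iS 2) (h11.1.const_mul 2), integral_const_mul, h11.2]
    ring
  · have : ∀ ω, (S ω + Z ω) ^ 4 = S ω ^ 4 + 4 * (S ω ^ 3 * Z ω) + 6 * (S ω ^ 2 * Z ω ^ 2)
        + 4 * (S ω * Z ω ^ 3) + Z ω ^ 4 := fun ω => by ring
    simp_rw [this]
    have a1 := h31.1.const_mul 4
    have a2 := h22.1.const_mul 6
    have a3 := h13.1.const_mul 4
    rw [integral_add ((((iS 4).fun_add a1).fun_add a2).fun_add a3) (iZ 4),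
      integral_add (((iS 4).fun_add a1).fun_add a2) a3, integral_add ((iS 4).fun_add a1) a2,
      integral_add (iS 4) a1, integral_const_mul, integral_const_mul, integral_const_mul,
      h31.2, h22.2, h13.2]
    ring

lemma moments_sum_of_iIndepFun {ι : Type*} {Y : ι → Ω → ℝ} (hY : ∀ j, Measurable (Y j))
    (hind : iIndepFun Y μ) {L b M : ℝ} (hL : ∀ j ω, |Y j ω| ≤ L)
    (h1 : ∀ j, ∫ ω, Y j ω ∂μ = 0) (h2 : ∀ j, ∫ ω, Y j ω ^ 2 ∂μ = b)
    (h4 : ∀ j, ∫ ω, Y j ω ^ 4 ∂μ ≤ M * b ^ 2) (hM : 3 ≤ M) (v : ι → ℝ) (s : Finset ι) :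
    ∫ ω, ∑ j ∈ s, v j * Y j ω ∂μ = 0 ∧
    ∫ ω, (∑ j ∈ s, v j * Y j ω) ^ 2 ∂μ = b * ∑ j ∈ s, v j ^ 2 ∧
    ∫ ω, (∑ j ∈ s, v j * Y j ω) ^ 4 ∂μ ≤ M * (b * ∑ j ∈ s, v j ^ 2) ^ 2 := by
  classical
  induction s using Finset.induction_on with
  | empty => simp
  | insert a s ha ih =>
    obtain ⟨e1, e2, e4⟩ := ih
    have hS : Measurable fun ω => ∑ j ∈ s, v j * Y j ω :=
      Finset.measurable_sum _ fun j _ => (hY j).const_mul _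
    have hZ : Measurable fun ω => v a * Y a ω := (hY a).const_mul _
    have hbS : ∀ ω, |∑ j ∈ s, v j * Y j ω| ≤ ∑ j ∈ s, |v j| * L := fun ω =>
      (Finset.abs_sum_le_sum_abs _ _).trans (Finset.sum_le_sum fun j _ => by
        rw [abs_mul]; exact mul_le_mul_of_nonneg_left (hL j ω) (abs_nonneg _))
    have hbZ : ∀ ω, |v a * Y a ω| ≤ |v a| * L := fun ω => by
      rw [abs_mul]; exact mul_le_mul_of_nonneg_left (hL a ω) (abs_nonneg _)
    have hi : IndepFun (fun ω => ∑ j ∈ s, v j * Y j ω) (fun ω => v a * Y a ω) μ := by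
      have h := (hind.comp (fun j x => v j * x)
        (fun j => measurable_id.const_mul (v j))).indepFun_finsetSum_of_notMem
        (fun j => (hY j).const_mul _) ha
      have he : (fun ω => ∑ j ∈ s, v j * Y j ω) = ∑ j ∈ s, (fun x => v j * x) ∘ Y j := by
        ext ω
        simp [Finset.sum_apply]
      rw [he]
      exact h
    have z1 : ∫ ω, v a * Y a ω ∂μ = 0 := by rw [integral_const_mul, h1, mul_zero]
    have z2 : ∫ ω, (v a * Y a ω) ^ 2 ∂μ = v a ^ 2 * b := by
      simp_rw [mul_pow]; rw [integral_const_mul, h2]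
    have z4 : ∫ ω, (v a * Y a ω) ^ 4 ∂μ ≤ v a ^ 4 * (M * b ^ 2) := by
      simp_rw [mul_pow]; rw [integral_const_mul]
      exact mul_le_mul_of_nonneg_left (h4 a) (by positivity)
    obtain ⟨m2, m4⟩ := moments_add_of_indepFun hS hZ hi hbS hbZ e1 z1
    have iS := integrable_pow_of_abs_le (μ := μ) hS hbS 1
    have iZ := integrable_pow_of_abs_le (μ := μ) hZ hbZ 1
    simp only [pow_one] at iS iZ
    simp_rw [Finset.sum_insert ha, add_comm (v a * Y a _)]
    refine ⟨by rw [integral_add iS iZ, e1, z1, add_zero], by rw [m2, e2, z2]; ring, ?_⟩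
    rw [m4, e2, z2]
    set T := ∑ j ∈ s, v j ^ 2
    have hT : 0 ≤ T := Finset.sum_nonneg fun j _ => sq_nonneg _
    have : 0 ≤ (M - 3) * (b ^ 2 * (T * v a ^ 2)) :=
      mul_nonneg (by linarith) (by positivity)
    nlinarith

/-- Paley–Zygmund inequality in terms of the second and fourth moments. -/
lemma measureReal_ge_of_fourth_moment {S : Ω → ℝ} (hS : Measurable S) {C s2 M : ℝ}
    (hC : ∀ ω, |S ω| ≤ C) (hs2 : 0 ≤ s2) (hM : 1 ≤ M) (h2 : ∫ ω, S ω ^ 2 ∂μ = s2)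
    (h4 : ∫ ω, S ω ^ 4 ∂μ ≤ M * s2 ^ 2) :
    1 / (2 * M) ≤ μ.real {ω | √s2 / 2 ≤ |S ω|} := by
  rcases hs2.eq_or_lt with h0 | hpos
  · have : {ω | √s2 / 2 ≤ |S ω|} = Set.univ := by
      ext ω; simp [← h0]
    rw [this, probReal_univ, div_le_one (by positivity)]
    linarith
  set T := {ω | √s2 / 2 ≤ |S ω|} with hT
  have hTm : MeasurableSet T := measurableSet_le measurable_const hS.abs
  have pt : ∀ ω, S ω ^ 2 ≤ s2 / 4 + (1 / (2 * M * s2)) * S ω ^ 4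
      + T.indicator (fun _ => M * s2 / 2) ω := by
    intro ω
    by_cases hω : ω ∈ T
    · rw [Set.indicator_of_mem hω]
      have : (1 / (2 * M * s2)) * S ω ^ 4 + M * s2 / 2 - S ω ^ 2
          = (S ω ^ 2 - M * s2) ^ 2 / (2 * M * s2) := by
        field_simp
        ring
      have h' : 0 ≤ (S ω ^ 2 - M * s2) ^ 2 / (2 * M * s2) := by positivity
      linarith
    · rw [Set.indicator_of_notMem hω]
      have h1 : |S ω| < √s2 / 2 := not_le.mp hω
      have h2 : |S ω| ^ 2 ≤ (√s2 / 2) ^ 2 := pow_le_pow_left₀ (abs_nonneg _) h1.le 2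
      rw [sq_abs, div_pow, Real.sq_sqrt hpos.le] at h2
      have : 0 ≤ (1 / (2 * M * s2)) * S ω ^ 4 := by positivity
      linarith
  have i4 := (integrable_pow_of_abs_le (μ := μ) hS hC 4).const_mul (1 / (2 * M * s2))
  have iT : Integrable (T.indicator fun _ => M * s2 / 2) μ :=
    (integrable_const _).indicator hTm
  have hint := integral_mono (μ := μ) (integrable_pow_of_abs_le hS hC 2)
    (((integrable_const (s2 / 4)).fun_add i4).fun_add iT) pt
  rw [h2] at hint
  rw [integral_add ((integrable_const (s2 / 4)).fun_add i4) iT, integral_add (integrable_const _) i4,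
    integral_const_mul, integral_indicator_const _ hTm] at hint
  simp only [integral_const, probReal_univ, smul_eq_mul, one_mul] at hint
  have h5 : (1 / (2 * M * s2)) * ∫ ω, S ω ^ 4 ∂μ ≤ s2 / 2 := by
    calc _ ≤ (1 / (2 * M * s2)) * (M * s2 ^ 2) := mul_le_mul_of_nonneg_left h4 (by positivity)
      _ = s2 / 2 := by field_simp
  rw [div_le_iff₀ (by positivity)]
  by_contra! hlt
  nlinarith

end Moments

/-- Symmetrization: an event covered by `F` and its preimage under a measure-preserving map has at
most twice the measure of `F`. -/
lemma measureReal_le_two_mul_of_subset_union_preimage {Ω : Type*} [MeasurableSpace Ω]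
    {μ : Measure Ω} [IsFiniteMeasure μ] {T : Ω → Ω} (hT : MeasurePreserving T μ μ) {E F : Set Ω}
    (hF : MeasurableSet F) (hE : E ⊆ F ∪ T ⁻¹' F) : μ.real E ≤ 2 * μ.real F := by
  calc μ.real E ≤ μ.real (F ∪ T ⁻¹' F) := measureReal_mono hE
    _ ≤ μ.real F + μ.real (T ⁻¹' F) := measureReal_union_le _ _
    _ = 2 * μ.real F := by rw [hT.measureReal_preimage hF.nullMeasurableSet]; ring

/-! ### Small-ball bounds for linear forms in symmetric variables -/

section SmallBall

lemma measurable_linearForm {ι : Type*} (v : ι → ℝ) (s : Finset ι) :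
    Measurable fun x : ι → ℝ => ∑ j ∈ s, v j * x j :=
  Finset.measurable_sum _ fun j _ => (measurable_pi_apply j).const_mul _

/-- A symmetric law is invariant under changing the sign of values outside `[-L, L]` only. -/
lemma measurePreserving_flip {ν : Measure ℝ} (hν : MeasurePreserving (fun x : ℝ => -x) ν ν) (L : ℝ) :
    MeasurePreserving (fun x : ℝ => if x ∈ Set.Icc (-L) L then x else -x) ν ν := by
  have hm : Measurable fun x : ℝ => if x ∈ Set.Icc (-L) L then x else -x :=
    Measurable.ite measurableSet_Icc measurable_id measurable_neg
  refine ⟨hm, Measure.ext fun s hs => ?_⟩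
  rw [Measure.map_apply hm hs]
  have hI : ∀ x : ℝ, -x ∈ Set.Icc (-L) L ↔ x ∈ Set.Icc (-L) L := fun x => by
    simp only [Set.mem_Icc]; constructor <;> rintro ⟨h1, h2⟩ <;> constructor <;> linarith
  have he : (fun x : ℝ => if x ∈ Set.Icc (-L) L then x else -x) ⁻¹' s
      = (s ∩ Set.Icc (-L) L) ∪ (fun x => -x) ⁻¹' (s \ Set.Icc (-L) L) := by
    ext x
    by_cases hx : x ∈ Set.Icc (-L) L
    · simp [Set.mem_preimage, hx, -Set.mem_Icc]
    · simp [Set.mem_preimage, hx, -Set.mem_Icc]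
  have hd : Disjoint (s ∩ Set.Icc (-L) L) ((fun x => -x) ⁻¹' (s \ Set.Icc (-L) L)) := by
    rw [Set.disjoint_left]
    rintro x ⟨-, hx⟩ ⟨-, hx'⟩
    exact hx' ((hI x).mpr hx)
  rw [he, measure_union hd (hν.measurable (hs.diff measurableSet_Icc)),
    hν.measure_preimage (hs.diff measurableSet_Icc).nullMeasurableSet,
    measure_inter_add_sdiff s measurableSet_Icc]

variable {ι : Type*} [Fintype ι] {ν : Measure ℝ} [IsProbabilityMeasure ν]

lemma integral_eval_pi (j : ι) {g : ℝ → ℝ} (hg : Measurable g) :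
    ∫ x, g (x j) ∂(Measure.pi fun _ : ι => ν) = ∫ y, g y ∂ν := by
  have h := (measurePreserving_eval (fun _ : ι => ν) j).map_eq
  conv_rhs => rw [← h]
  rw [integral_map (measurable_pi_apply j).aemeasurable hg.aestronglyMeasurable]

/-- A linear form in independent symmetric variables exceeds a multiple of the `ℓ₂`-norm of its
coefficients with probability bounded below, in terms of a truncated second moment only. The form
`S'` in the truncated variables satisfies the Paley–Zygmund inequality; writing `S = S' + S''`, the
pairs `(S', S'')` and `(S', -S'')` have the same law, so `S' ≥ t` costs at most a factor `2`
compared with `S ≥ t`. -/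
lemma block_small_ball (hν : MeasurePreserving (fun x : ℝ => -x) ν ν) {L b M : ℝ} (hL : 0 ≤ L)
    (hb : ∫ x in Set.Icc (-L) L, x ^ 2 ∂ν = b) (hb0 : 0 < b) (hM : 3 ≤ M) (hLM : L ^ 2 ≤ M * b)
    (v : ι → ℝ) (s : Finset ι) :
    1 / (8 * M) ≤ (Measure.pi fun _ : ι => ν).real
      {x | √b / 2 * √(∑ j ∈ s, v j ^ 2) ≤ ∑ j ∈ s, v j * x j} := by
  set I := Set.Icc (-L) L with hI
  set h : ℝ → ℝ := I.indicator fun x => x with hh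
  set ρ := Measure.pi fun _ : ι => ν with hρ
  have hm : Measurable h := measurable_id.indicator measurableSet_Icc
  have hbd : ∀ x, |h x| ≤ L := fun x => by
    by_cases hx : x ∈ I
    · rw [hh, Set.indicator_of_mem hx]; exact abs_le.mpr hx
    · rw [hh, Set.indicator_of_notMem hx]; simpa using hL
  have hodd : ∀ x, h (-x) = -h x := fun x => by
    have hx' : -x ∈ I ↔ x ∈ I := by
      simp only [hI, Set.mem_Icc]; constructor <;> rintro ⟨h1, h2⟩ <;> constructor <;> linarith
    by_cases hx : x ∈ I
    · rw [hh, Set.indicator_of_mem hx, Set.indicator_of_mem (hx'.mpr hx)]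
    · rw [hh, Set.indicator_of_notMem hx, Set.indicator_of_notMem (fun h => hx (hx'.mp h)), neg_zero]
  have m1 : ∫ x, h x ∂ν = 0 := by
    have h1 := hν.integral_comp (MeasurableEquiv.neg ℝ).measurableEmbedding h
    simp only [hodd, integral_neg] at h1
    linarith
  have m2 : ∫ x, h x ^ 2 ∂ν = b := by
    rw [← hb, ← integral_indicator measurableSet_Icc]
    refine integral_congr_ae (.of_forall fun x => ?_)
    show h x ^ 2 = I.indicator (fun x => x ^ 2) x
    by_cases hx : x ∈ I
    · rw [hh, Set.indicator_of_mem hx, Set.indicator_of_mem hx]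
    · rw [hh, Set.indicator_of_notMem hx, Set.indicator_of_notMem hx]; norm_num
  have m4 : ∫ x, h x ^ 4 ∂ν ≤ M * b ^ 2 := by
    calc ∫ x, h x ^ 4 ∂ν ≤ ∫ x, L ^ 2 * h x ^ 2 ∂ν := by
          refine integral_mono (integrable_pow_of_abs_le hm hbd 4)
            ((integrable_pow_of_abs_le hm hbd 2).const_mul _) fun x => ?_
          have : h x ^ 2 ≤ L ^ 2 := sq_le_sq' (abs_le.mp (hbd x)).1 (abs_le.mp (hbd x)).2
          show h x ^ 4 ≤ L ^ 2 * h x ^ 2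
          nlinarith [sq_nonneg (h x)]
      _ = L ^ 2 * b := by rw [integral_const_mul, m2]
      _ ≤ M * b ^ 2 := by nlinarith
  have hYm : ∀ j : ι, Measurable fun x : ι → ℝ => h (x j) := fun j => hm.comp (measurable_pi_apply j)
  have hind : iIndepFun (fun (j : ι) (x : ι → ℝ) => h (x j)) ρ :=
    iIndepFun_pi (X := fun _ : ι => h) fun _ => hm.aemeasurable
  obtain ⟨-, q2, q4⟩ := moments_sum_of_iIndepFun (μ := ρ) hYm hind (L := L) (b := b) (M := M)
    (fun j x => hbd _) (fun j => by rw [hρ, integral_eval_pi j hm, m1])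
    (fun j => by rw [hρ, integral_eval_pi j (g := fun y => h y ^ 2) (hm.pow_const 2), m2])
    (fun j => by rw [hρ, integral_eval_pi j (g := fun y => h y ^ 4) (hm.pow_const 4)]; exact m4)
    hM v s
  set t := √b / 2 * √(∑ j ∈ s, v j ^ 2) with ht
  have hS'm : Measurable fun x : ι → ℝ => ∑ j ∈ s, v j * h (x j) :=
    Finset.measurable_sum _ fun j _ => (hYm j).const_mul _
  have p1 := measureReal_ge_of_fourth_moment (μ := ρ) (M := M) hS'm
    (C := ∑ j ∈ s, |v j| * L) (fun x => (Finset.abs_sum_le_sum_abs _ _).trans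
      (Finset.sum_le_sum fun j _ => by
        rw [abs_mul]; exact mul_le_mul_of_nonneg_left (hbd _) (abs_nonneg _)))
    (s2 := b * ∑ j ∈ s, v j ^ 2)
    (mul_nonneg hb0.le (Finset.sum_nonneg fun j _ => sq_nonneg _)) (by linarith) q2 q4
  have ht' : √(b * ∑ j ∈ s, v j ^ 2) / 2 = t := by
    rw [ht, Real.sqrt_mul hb0.le]; ring
  rw [ht'] at p1
  -- the sign of the truncated form is symmetric: flip all coordinates
  have p2 : ρ.real {x | t ≤ |∑ j ∈ s, v j * h (x j)|}
      ≤ 2 * ρ.real {x | t ≤ ∑ j ∈ s, v j * h (x j)} := by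
    refine measureReal_le_two_mul_of_subset_union_preimage
      (measurePreserving_pi (fun _ : ι => ν) (fun _ => ν) fun _ => hν)
      (measurableSet_le measurable_const hS'm) fun x hx => ?_
    rcases le_abs.mp (show t ≤ |∑ j ∈ s, v j * h (x j)| from hx) with hx | hx
    · exact Or.inl hx
    · refine Or.inr ?_
      show t ≤ ∑ j ∈ s, v j * h (-x j)
      simpa only [hodd, mul_neg, Finset.sum_neg_distrib] using hx
  -- flipping only the untruncated coordinates, the two values of the form have mean `S'`
  have p3 : ρ.real {x | t ≤ ∑ j ∈ s, v j * h (x j)}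
      ≤ 2 * ρ.real {x | t ≤ ∑ j ∈ s, v j * x j} := by
    refine measureReal_le_two_mul_of_subset_union_preimage
      (measurePreserving_pi (fun _ : ι => ν) (fun _ => ν) fun _ => measurePreserving_flip hν L)
      (measurableSet_le measurable_const (measurable_linearForm v s)) fun x hx => ?_
    by_contra! hcon
    rw [Set.mem_union, not_or] at hcon
    obtain ⟨c1, c2⟩ := hcon
    have c1 : ∑ j ∈ s, v j * x j < t := not_le.mp c1
    have c2 : ∑ j ∈ s, v j * (if x j ∈ I then x j else -x j) < t := not_le.mp c2
    have hx : t ≤ ∑ j ∈ s, v j * h (x j) := hx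
    have : ∑ j ∈ s, v j * x j + ∑ j ∈ s, v j * (if x j ∈ I then x j else -x j)
        = 2 * ∑ j ∈ s, v j * h (x j) := by
      rw [← Finset.sum_add_distrib, Finset.mul_sum]
      refine Finset.sum_congr rfl fun j _ => ?_
      by_cases hj : x j ∈ I
      · rw [if_pos hj, hh, Set.indicator_of_mem hj]; ring
      · rw [if_neg hj, hh, Set.indicator_of_notMem hj]; ring
    linarith
  have : 1 / (8 * M) = 1 / (2 * M) / 4 := by rw [div_div]; ring_nf
  rw [this]
  linarith

lemma measureReal_linearForm_mul_le [DecidableEq ι] (v : ι → ℝ) {s t : Finset ι}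
    (hst : Disjoint s t) (a b : ℝ) :
    (Measure.pi fun _ : ι => ν).real {x | a ≤ ∑ j ∈ s, v j * x j} *
        (Measure.pi fun _ : ι => ν).real {x | b ≤ ∑ j ∈ t, v j * x j}
      ≤ (Measure.pi fun _ : ι => ν).real {x | a + b ≤ ∑ j ∈ s ∪ t, v j * x j} := by
  set ρ := Measure.pi fun _ : ι => ν with hρ
  have hind : iIndepFun (fun (j : ι) (x : ι → ℝ) => x j) ρ :=
    iIndepFun_pi (X := fun _ : ι => fun y : ℝ => y) fun _ => aemeasurable_id
  have h := hind.indepFun_finset s t hst fun j => measurable_pi_apply j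
  have h' := h.comp (φ := fun y : s → ℝ => ∑ j : s, v j * y j)
    (ψ := fun y : t → ℝ => ∑ j : t, v j * y j)
    (Finset.measurable_sum _ fun j _ => (measurable_pi_apply j).const_mul _)
    (Finset.measurable_sum _ fun j _ => (measurable_pi_apply j).const_mul _)
  have h2 := h'.measure_inter_preimage_eq_mul (Set.Ici a) (Set.Ici b) measurableSet_Ici
    measurableSet_Ici
  have e1 : ((fun y : s → ℝ => ∑ j : s, v j * y j) ∘ fun (x : ι → ℝ) (i : s) => x i) ⁻¹' Set.Ici a
      = {x | a ≤ ∑ j ∈ s, v j * x j} := by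
    ext x; simp only [Set.mem_preimage, Function.comp, Set.mem_Ici, Set.mem_ofPred_eq]
    rw [Finset.sum_coe_sort s fun j => v j * x j]
  have e2 : ((fun y : t → ℝ => ∑ j : t, v j * y j) ∘ fun (x : ι → ℝ) (i : t) => x i) ⁻¹' Set.Ici b
      = {x | b ≤ ∑ j ∈ t, v j * x j} := by
    ext x; simp only [Set.mem_preimage, Function.comp, Set.mem_Ici, Set.mem_ofPred_eq]
    rw [Finset.sum_coe_sort t fun j => v j * x j]
  rw [e1, e2] at h2
  rw [measureReal_def, measureReal_def, ← ENNReal.toReal_mul, ← h2]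
  refine measureReal_mono ?_
  rintro x ⟨hx1, hx2⟩
  show a + b ≤ _
  rw [Finset.sum_union hst]
  exact add_le_add hx1 hx2

lemma prod_le_measureReal_linearForm {κ : Type*} [DecidableEq ι] (v : ι → ℝ) (K : Finset κ)
    (B : κ → Finset ι) (hB : (K : Set κ).PairwiseDisjoint B) (t p : κ → ℝ) (hp : ∀ k ∈ K, 0 ≤ p k)
    (h : ∀ k ∈ K, p k ≤ (Measure.pi fun _ : ι => ν).real {x | t k ≤ ∑ j ∈ B k, v j * x j}) :
    ∏ k ∈ K, p k ≤ (Measure.pi fun _ : ι => ν).real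
      {x | ∑ k ∈ K, t k ≤ ∑ j ∈ K.biUnion B, v j * x j} := by
  classical
  induction K using Finset.induction_on with
  | empty => simp
  | insert a K ha ih =>
    have hK := ih (hB.subset (by simp)) (fun k hk => hp k (Finset.mem_insert_of_mem hk))
      (fun k hk => h k (Finset.mem_insert_of_mem hk))
    rw [Finset.prod_insert ha, Finset.sum_insert ha, Finset.biUnion_insert]
    have hd : Disjoint (B a) (K.biUnion B) := by
      rw [Finset.disjoint_biUnion_right]
      intro k hk
      exact hB (by simp) (by simp [hk]) (by rintro rfl; exact ha hk)
    refine le_trans ?_ (measureReal_linearForm_mul_le v hd _ _)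
    exact mul_le_mul (h a (by simp)) hK
      (Finset.prod_nonneg fun k hk => hp k (Finset.mem_insert_of_mem hk)) measureReal_nonneg

lemma singleton_small_ball [DecidableEq ι] (hν : MeasurePreserving (fun x : ℝ => -x) ν ν)
    (v : ι → ℝ) (j : ι) {r : ℝ} :
    ν.real {x | r ≤ x} ≤ (Measure.pi fun _ : ι => ν).real
      {x | |v j| * r ≤ ∑ i ∈ {j}, v i * x i} := by
  simp only [Finset.sum_singleton]
  have hr : MeasurableSet {x : ℝ | r ≤ x} := measurableSet_Ici
  have hev := measurePreserving_eval (fun _ : ι => ν) j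
  rcases le_total 0 (v j) with hv | hv
  · rw [← hev.measureReal_preimage hr.nullMeasurableSet]
    refine measureReal_mono fun x hx => ?_
    show |v j| * r ≤ _
    rw [abs_of_nonneg hv]
    exact mul_le_mul_of_nonneg_left hx hv
  · rw [← hν.measureReal_preimage hr.nullMeasurableSet,
      ← hev.measureReal_preimage (hν.measurable hr).nullMeasurableSet]
    refine measureReal_mono fun x hx => ?_
    show |v j| * r ≤ _
    have hx : r ≤ -x j := hx
    rw [abs_of_nonpos hv]
    nlinarith

/-- The small-ball bound for one column: up to constants, `⟨x, v⟩ ≥ c ⟨w, v⟩` has probability at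
least `exp (-C τ)` whenever `‖w‖₂² ≤ τ`. The hypothesis `hbig` on the tail of the entries is needed
only where `|w j| > 1`. -/
theorem small_ball [DecidableEq ι] (hν : MeasurePreserving (fun x : ℝ => -x) ν ν)
    {L b M c c₀ C₀ : ℝ}
    (hL : 0 ≤ L) (hb : ∫ x in Set.Icc (-L) L, x ^ 2 ∂ν = b) (hb0 : 0 < b) (hM : 3 ≤ M)
    (hLM : L ^ 2 ≤ M * b) {τ : ℕ} (hτ : 0 < τ) (v w : ι → ℝ) (hw : ∑ j, w j ^ 2 ≤ τ)
    (hC₀ : 0 ≤ C₀) (hc : 0 ≤ c) (hcb : 3 * c ≤ √b) (hcc : c ≤ c₀)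
    (hbig : ∀ j, 1 < |w j| → Real.exp (-(C₀ * w j ^ 2)) ≤ ν.real {x | c₀ * |w j| ≤ x}) :
    (1 / (8 * M) * Real.exp (-C₀)) ^ τ ≤ (Measure.pi fun _ : ι => ν).real
      {x | c * ∑ j, w j * v j ≤ ∑ j, v j * x j} := by
  set S : Finset ι := Finset.univ.filter fun j => |w j| ≤ 1 with hS
  set T : Finset ι := Finset.univ.filter fun j => ¬ |w j| ≤ 1 with hT
  have hST : Disjoint S T := Finset.disjoint_filter_filter_not _ _ _
  have hSTu : S ∪ T = Finset.univ := Finset.filter_union_filter_not_eq _ _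
  have hsq : ∀ s : Finset ι, ∑ j ∈ s, w j ^ 2 ≤ τ := fun s =>
    (Finset.sum_le_univ_sum_of_nonneg fun j => sq_nonneg _).trans hw
  obtain ⟨f, hf⟩ := exists_packing S (fun j => w j ^ 2) hτ (fun j _ => sq_nonneg _)
    (fun j hj => by
      have := (Finset.mem_filter.mp hj).2
      rw [← sq_abs]; exact pow_le_one₀ (abs_nonneg _) this) (hsq S)
  have hq : (0 : ℝ) ≤ 1 / (8 * M) := by positivity
  -- the bins of small coordinates
  have h1 := prod_le_measureReal_linearForm (ν := ν) v (Finset.univ : Finset (Fin τ))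
    (fun k => S.filter fun j => f j = k)
    (fun k _ l _ hkl => Finset.disjoint_left.mpr fun j hj hj' =>
      hkl ((Finset.mem_filter.mp hj).2.symm.trans (Finset.mem_filter.mp hj').2))
    (fun k => √b / 2 * √(∑ j ∈ S with f j = k, v j ^ 2)) (fun _ => 1 / (8 * M)) (fun _ _ => hq)
    (fun k _ => block_small_ball hν hL hb hb0 hM hLM v _)
  have hbi : (Finset.univ : Finset (Fin τ)).biUnion (fun k => S.filter fun j => f j = k) = S := by
    ext j; simp
  rw [hbi, Finset.prod_const, Finset.card_univ, Fintype.card_fin] at h1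
  -- the large coordinates, one by one
  have h2 := prod_le_measureReal_linearForm (ν := ν) v T (fun j => {j})
    (fun i _ j _ hij => Finset.disjoint_singleton.mpr hij)
    (fun j => |v j| * (c₀ * |w j|)) (fun j => Real.exp (-(C₀ * w j ^ 2)))
    (fun j _ => (Real.exp_pos _).le)
    (fun j hj => (hbig j (not_le.mp (Finset.mem_filter.mp hj).2)).trans
      (singleton_small_ball hν v j))
  rw [Finset.biUnion_singleton_eq_self, ← Real.exp_sum, Finset.sum_neg_distrib,
    ← Finset.mul_sum] at h2
  have h3 := measureReal_linearForm_mul_le (ν := ν) v hST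
    (∑ k, √b / 2 * √(∑ j ∈ S with f j = k, v j ^ 2)) (∑ j ∈ T, |v j| * (c₀ * |w j|))
  rw [hSTu] at h3
  have h4 : (1 / (8 * M) * Real.exp (-C₀)) ^ τ
      ≤ (1 / (8 * M)) ^ τ * Real.exp (-(C₀ * ∑ j ∈ T, w j ^ 2)) := by
    rw [mul_pow, ← Real.exp_nat_mul]
    refine mul_le_mul_of_nonneg_left (Real.exp_le_exp.mpr ?_) (pow_nonneg hq _)
    nlinarith [hsq T]
  refine h4.trans ((mul_le_mul h1 h2 (Real.exp_pos _).le measureReal_nonneg).trans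
    (h3.trans (measureReal_mono fun x hx => ?_)))
  refine le_trans ?_ (show _ ≤ ∑ j, v j * x j from hx)
  have hu : ∑ j, w j * v j = ∑ j ∈ S, w j * v j + ∑ j ∈ T, w j * v j := by
    rw [← Finset.sum_union hST, hSTu]
  rw [hu, mul_add]
  refine add_le_add ?_ ?_
  · rw [← Finset.sum_fiberwise S f, Finset.mul_sum]
    refine Finset.sum_le_sum fun k _ => ?_
    have hcs := Real.sum_mul_le_sqrt_mul_sqrt (S.filter fun j => f j = k) w v
    have h2' : √(∑ j ∈ S with f j = k, w j ^ 2) ≤ 3 / 2 := by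
      rw [Real.sqrt_le_left (by norm_num)]
      exact (hf k).trans (by norm_num)
    set A := √(∑ j ∈ S with f j = k, v j ^ 2)
    have hA : 0 ≤ A := Real.sqrt_nonneg _
    calc c * ∑ j ∈ S with f j = k, w j * v j ≤ c * (3 / 2 * A) :=
          mul_le_mul_of_nonneg_left (hcs.trans (mul_le_mul_of_nonneg_right h2' hA)) hc
      _ ≤ √b / 2 * A := by nlinarith
  · rw [Finset.mul_sum]
    refine Finset.sum_le_sum fun j _ => ?_
    calc c * (w j * v j) ≤ c * (|w j| * |v j|) := by
          rw [← abs_mul]; exact mul_le_mul_of_nonneg_left (le_abs_self _) hc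
      _ ≤ c₀ * (|w j| * |v j|) := mul_le_mul_of_nonneg_right hcc (by positivity)
      _ = |v j| * (c₀ * |w j|) := by ring

end SmallBall

/-! ### Vertices of a polytope -/

/-- A linear functional on a bounded polytope `{v | ∀ i, ⟨a i, v⟩ ≤ 1}` is maximal at a point with
`m` linearly independent active constraints. -/
lemma exists_vertex {m : ℕ} {ι : Type*} [Finite ι] (a : ι → Fin m → ℝ)
    (hbdd : Bornology.IsBounded {v : Fin m → ℝ | ∀ i, a i ⬝ᵥ v ≤ 1}) (w v₀ : Fin m → ℝ)
    (hv₀ : ∀ i, a i ⬝ᵥ v₀ ≤ 1) :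
    ∃ v : Fin m → ℝ, (∀ i, a i ⬝ᵥ v ≤ 1) ∧ w ⬝ᵥ v₀ ≤ w ⬝ᵥ v ∧
      ∃ g : Fin m → ι, Function.Injective g ∧ LinearIndependent ℝ (a ∘ g) ∧
        ∀ k, a (g k) ⬝ᵥ v = 1 := by
  classical
  set P := {v : Fin m → ℝ | ∀ i, a i ⬝ᵥ v ≤ 1} with hP
  have hcont : ∀ u : Fin m → ℝ, Continuous fun v : Fin m → ℝ => u ⬝ᵥ v := fun u =>
    continuous_const.dotProduct continuous_id
  have hclosed : IsClosed P := by
    rw [hP, Set.ofPred_forall]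
    exact isClosed_iInter fun i => isClosed_le (hcont _) continuous_const
  have hcomp : IsCompact P := Metric.isCompact_of_isClosed_isBounded hclosed hbdd
  let l : StrongDual ℝ (Fin m → ℝ) :=
    ⟨{ toFun := fun v => w ⬝ᵥ v
       map_add' := fun x y => dotProduct_add w x y
       map_smul' := fun c x => by simp [dotProduct_smul] }, hcont w⟩
  have hl : ∀ v, l v = w ⬝ᵥ v := fun v => rfl
  have hexp : IsExposed ℝ P (l.toExposed P) := ContinuousLinearMap.toExposed.isExposed
  have hne : (l.toExposed P).Nonempty := by
    obtain ⟨x, hx, hmax⟩ := hcomp.exists_isMaxOn ⟨v₀, hv₀⟩ l.continuous.continuousOn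
    exact ⟨x, hx, fun y hy => hmax hy⟩
  obtain ⟨v, hv⟩ := (hexp.isCompact hcomp).extremePoints_nonempty hne
  have hvP : v ∈ P := hv.1.1
  have hvext := hexp.isExtreme.extremePoints_subset_extremePoints hv
  refine ⟨v, hvP, hv.1.2 v₀ hv₀, ?_⟩
  -- the active constraints span the dual space
  set act : Set ι := {i | a i ⬝ᵥ v = 1} with hact
  have hspan : Submodule.span ℝ (Set.range fun i : act => a i) = ⊤ := by
    by_contra hne
    obtain ⟨f, hf0, hf⟩ := Submodule.exists_le_ker_of_lt_top _ (lt_top_iff_ne_top.mpr hne)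
    set z : Fin m → ℝ := fun j => f (Pi.single j 1) with hz
    have hfz : ∀ u : Fin m → ℝ, f u = u ⬝ᵥ z := fun u => by
      conv_lhs => rw [pi_eq_sum_univ' u]
      simp [dotProduct, hz]
    have hz0 : z ≠ 0 := by
      rintro h0
      exact hf0 (LinearMap.ext fun u => by rw [hfz, h0]; simp)
    have haz : ∀ i ∈ act, a i ⬝ᵥ z = 0 := fun i hi => by
      rw [← hfz]
      exact hf (Submodule.subset_span ⟨⟨i, hi⟩, rfl⟩)
    have hev : ∀ᶠ t in nhds (0 : ℝ), ∀ i, a i ⬝ᵥ (v + t • z) ≤ 1 := by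
      rw [Filter.eventually_all]
      intro i
      by_cases hi : i ∈ act
      · refine Filter.Eventually.of_forall fun t => ?_
        rw [dotProduct_add, dotProduct_smul, haz i hi, smul_zero, add_zero]
        exact hvP i
      · have hlt : a i ⬝ᵥ (v + (0 : ℝ) • z) < 1 := by
          rw [zero_smul, add_zero]; exact lt_of_le_of_ne (hvP i) hi
        have hc : Continuous fun t : ℝ => a i ⬝ᵥ (v + t • z) :=
          (hcont (a i)).comp (by fun_prop)
        exact (hc.continuousAt.eventually_lt continuousAt_const hlt).mono fun t ht => ht.le
    have hev' : ∀ᶠ t in nhds (0 : ℝ), ∀ i, a i ⬝ᵥ (v + (-t) • z) ≤ 1 := by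
      have : Filter.Tendsto (fun t : ℝ => -t) (nhds 0) (nhds 0) := by
        simpa using (continuous_neg (G := ℝ)).tendsto 0
      exact this.eventually hev
    obtain ⟨δ, hδ, hball⟩ := Metric.eventually_nhds_iff.mp (hev.and hev')
    obtain ⟨h1, h2⟩ := hball (y := δ / 2) (by
      rw [Real.dist_eq, sub_zero, abs_of_pos (by positivity)]; linarith)
    have hmid : v ∈ openSegment ℝ (v + (δ / 2) • z) (v + (-(δ / 2)) • z) :=
      ⟨1 / 2, 1 / 2, by norm_num, by norm_num, by norm_num, by
        ext j; simp only [Pi.add_apply, Pi.smul_apply, smul_eq_mul]; ring⟩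
    have := hvext.2 h1 h2 hmid
    have h0 : (δ / 2) • z = 0 := by simpa using this
    exact (smul_ne_zero (by positivity) hz0) h0
  obtain ⟨κ, g, hg, hsp, hli⟩ := exists_linearIndependent' ℝ (fun i : act => a i)
  rw [hspan] at hsp
  have hκ : Finite κ := Finite.of_injective _ hg
  have := Fintype.ofFinite κ
  have hcard : Fintype.card κ = m := by
    have h1 := finrank_span_eq_card hli
    rw [hsp, finrank_top, Module.finrank_fin_fun] at h1
    exact h1.symm
  let e : Fin m ≃ κ := (Fintype.equivFinOfCardEq hcard).symm
  refine ⟨fun k => (g (e k) : ι), fun k k' h => e.injective (hg (Subtype.ext h)),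
    ?_, fun k => (g (e k)).2⟩
  exact hli.comp e e.injective

/-- The solution `v` of the system `⟨u k, v⟩ = 1` for all `k`. For dependent `u` the matrix inverse is
zero and so is this vector; only the independent case is used. -/
noncomputable def activeVertex {m : ℕ} (u : Fin m → Fin m → ℝ) : Fin m → ℝ :=
  (Matrix.of u)⁻¹.mulVec 1

lemma eq_activeVertex {m : ℕ} {u : Fin m → Fin m → ℝ} (hu : LinearIndependent ℝ u)
    {v : Fin m → ℝ} (hv : ∀ k, u k ⬝ᵥ v = 1) : v = activeVertex u := by
  have hunit : IsUnit (Matrix.of u) :=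
    Matrix.linearIndependent_rows_iff_isUnit.mp hu
  have hmul : (Matrix.of u).mulVec v = 1 := by
    ext k; exact hv k
  rw [activeVertex, ← hmul, Matrix.mulVec_mulVec,
    Matrix.nonsing_inv_mul _ ((Matrix.isUnit_iff_isUnit_det _).mp hunit), Matrix.one_mulVec]

lemma measurable_activeVertex {m : ℕ} :
    Measurable (activeVertex : (Fin m → Fin m → ℝ) → Fin m → ℝ) := by
  refine measurable_pi_lambda _ fun k => ?_
  have h1 : Measurable fun u : Fin m → Fin m → ℝ => (Matrix.of u).det :=
    have hof : Continuous fun u : Fin m → Fin m → ℝ => Matrix.of u := continuous_id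
    hof.matrix_det.measurable
  have h2 : Measurable fun u : Fin m → Fin m → ℝ => ((Matrix.of u).adjugate.mulVec 1) k := by
    have hof : Continuous fun u : Fin m → Fin m → ℝ => Matrix.of u := continuous_id
    have hc : Continuous fun u : Fin m → Fin m → ℝ => (Matrix.of u).adjugate.mulVec 1 :=
      hof.matrix_adjugate.matrix_mulVec continuous_const
    exact ((continuous_apply k).comp hc).measurable
  have : (fun u : Fin m → Fin m → ℝ => activeVertex u k)
      = fun u => (Matrix.of u).det⁻¹ * ((Matrix.of u).adjugate.mulVec 1) k := by
    ext u
    rw [activeVertex, Matrix.inv_def, Matrix.smul_mulVec, Ring.inverse_eq_inv', Pi.smul_apply,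
      smul_eq_mul]
  rw [this]
  exact h1.inv.mul h2

/-! ### The union bound over vertices -/

/-- Let `V` be a function of the coordinates in `T` of an independent sample. The probability that
`V` takes a value whose section of `G` has measure at most `q`, while all the remaining coordinates
lie in that section, is at most `q` to the number of remaining coordinates. -/
lemma measure_pi_forall_notMem_le {ι E F : Type*} [Fintype ι] [DecidableEq ι] [MeasurableSpace E]
    [MeasurableSpace F] [Inhabited E] (ρ : Measure E) [IsProbabilityMeasure ρ] (T : Finset ι)
    {V : (ι → E) → F} (hV : Measurable V)
    (hdep : ∀ A A' : ι → E, (∀ i ∈ T, A i = A' i) → V A = V A')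
    {G : Set (F × E)} (hG : MeasurableSet G) (q : ENNReal) :
    Measure.pi (fun _ : ι => ρ)
      {A | ρ {a | (V A, a) ∈ G} ≤ q ∧ ∀ i ∉ T, (V A, A i) ∈ G} ≤ q ^ (Fintype.card ι - T.card) := by
  set e := MeasurableEquiv.piEquivPiSubtypeProd (fun _ : ι => E) (fun i => i ∈ T) with he
  have hmp := measurePreserving_piEquivPiSubtypeProd (fun _ : ι => ρ) (fun i => i ∈ T)
  set V' : ({i // i ∈ T} → E) → F := fun x => V (e.symm (x, fun _ => default)) with hV'
  have hV'm : Measurable V' := hV.comp (e.symm.measurable.comp (by fun_prop))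
  have hVV' : ∀ A, V A = V' (e A).1 := fun A => hdep _ _ fun i hi => by
    simp [he, MeasurableEquiv.piEquivPiSubtypeProd, Equiv.piEquivPiSubtypeProd, hi]
  set D : Set (({i // i ∈ T} → E) × ({i // i ∉ T} → E)) :=
    {z | ρ {a | (V' z.1, a) ∈ G} ≤ q ∧ ∀ i, (V' z.1, z.2 i) ∈ G} with hD
  have hDm : MeasurableSet D := by
    refine MeasurableSet.inter ?_ ?_
    · have h1 : Measurable fun y : F => ρ (Prod.mk y ⁻¹' G) := measurable_measure_prodMk_left hG
      exact measurableSet_le (h1.comp (hV'm.comp measurable_fst)) measurable_const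
    · have hset : {z : ({i // i ∈ T} → E) × ({i // i ∉ T} → E) | ∀ i, (V' z.1, z.2 i) ∈ G}
          = ⋂ i, {z | (V' z.1, z.2 i) ∈ G} := Set.ofPred_forall _
      change MeasurableSet {z : ({i // i ∈ T} → E) × ({i // i ∉ T} → E) |
        ∀ i, (V' z.1, z.2 i) ∈ G}
      rw [hset]
      refine MeasurableSet.iInter fun i => ?_
      exact ((hV'm.comp measurable_fst).prodMk
        ((measurable_pi_apply i).comp measurable_snd)) hG
  have hset : {A | ρ {a | (V A, a) ∈ G} ≤ q ∧ ∀ i ∉ T, (V A, A i) ∈ G} = e ⁻¹' D := by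
    ext A
    simp only [Set.mem_preimage, hD, Set.mem_ofPred_eq, ← hVV']
    refine and_congr_right fun _ => ?_
    rw [Subtype.forall]
    rfl
  rw [hset, hmp.measure_preimage hDm.nullMeasurableSet, Measure.prod_apply hDm]
  refine (lintegral_mono (g := fun _ => q ^ (Fintype.card ι - T.card)) fun x => ?_).trans
    (by simp)
  by_cases hx : ρ {a | (V' x, a) ∈ G} ≤ q
  · have hsub : Prod.mk x ⁻¹' D ⊆ Set.pi Set.univ fun _ => {a | (V' x, a) ∈ G} :=
      fun y hy i _ => hy.2 i
    refine (measure_mono hsub).trans ?_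
    rw [Measure.pi_pi, Finset.prod_const, Finset.card_univ, Fintype.card_subtype_compl,
      Fintype.card_coe]
    exact pow_le_pow_left' hx _
  · have : Prod.mk x ⁻¹' D = ∅ := Set.eq_empty_of_forall_notMem fun y hy => hx hy.1
    rw [this, measure_empty]
    exact zero_le

/-- If every `v` with `⟨w, v⟩ ≥ R` for some `w ∈ W` has `|⟨x, v⟩| ≤ 1` with probability at most `q`,
then with high probability no such `v` satisfies this for all `N` columns. The polytope
`{v | ∀ i, |⟨A i, v⟩| ≤ 1}` may be unbounded, so it is exhausted by its intersections with boxes. -/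
theorem measure_exists_large_le {m N : ℕ} (ρ : Measure (Fin m → ℝ)) [IsProbabilityMeasure ρ]
    (W : Set (Fin m → ℝ)) (R : ℝ) {q : ENNReal} (hq : q ≤ 1)
    (h : ∀ w ∈ W, ∀ v : Fin m → ℝ, R ≤ w ⬝ᵥ v → ρ {a | |a ⬝ᵥ v| ≤ 1} ≤ q) :
    Measure.pi (fun _ : Fin N => ρ)
      {A | ∃ w ∈ W, ∃ v : Fin m → ℝ, R ≤ w ⬝ᵥ v ∧ ∀ i, |A i ⬝ᵥ v| ≤ 1}
      ≤ ((2 * (N + m)).choose m : ENNReal) * q ^ (N - m) := by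
  classical
  set π := Measure.pi (fun _ : Fin N => ρ) with hπ
  set F : ℕ → Set (Fin N → Fin m → ℝ) := fun M =>
    {A | ∃ w ∈ W, ∃ v : Fin m → ℝ, R ≤ w ⬝ᵥ v ∧ (∀ i, |A i ⬝ᵥ v| ≤ 1) ∧ ∀ j, |v j| ≤ M + 1} with hF
  have hmono : Monotone F := fun M M' hMM A ⟨w, hw, v, h1, h2, h3⟩ =>
    ⟨w, hw, v, h1, h2, fun j => (h3 j).trans (by gcongr)⟩
  have hUn : {A : Fin N → Fin m → ℝ | ∃ w ∈ W, ∃ v : Fin m → ℝ, R ≤ w ⬝ᵥ v ∧ ∀ i, |A i ⬝ᵥ v| ≤ 1}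
      = ⋃ M, F M := by
    ext A
    simp only [Set.mem_ofPred_eq, Set.mem_iUnion, hF]
    constructor
    · rintro ⟨w, hw, v, h1, h2⟩
      obtain ⟨M, hM⟩ := exists_nat_ge ‖v‖
      exact ⟨M, w, hw, v, h1, h2, fun j => by
        have := norm_le_pi_norm v j
        rw [Real.norm_eq_abs] at this
        linarith⟩
    · rintro ⟨M, w, hw, v, h1, h2, -⟩
      exact ⟨w, hw, v, h1, h2⟩
  rw [hUn, hmono.measure_iUnion]
  refine iSup_le fun M => ?_
  set ε : ℝ := 1 / (M + 1) with hε
  have hM : (0 : ℝ) < M + 1 := by positivity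
  -- the constraints, with the box `|v j| ≤ M + 1` added to make the polytope bounded
  let ι := (Fin N ⊕ Fin m) ⊕ (Fin N ⊕ Fin m)
  let half : (Fin N → Fin m → ℝ) → Fin N ⊕ Fin m → Fin m → ℝ := fun A =>
    Sum.elim A fun j => Pi.single j ε
  let a : (Fin N → Fin m → ℝ) → ι → Fin m → ℝ := fun A => Sum.elim (half A) (-half A)
  have ha : ∀ A v, (∀ i, a A i ⬝ᵥ v ≤ 1) ↔ (∀ i, |A i ⬝ᵥ v| ≤ 1) ∧ ∀ j, |v j| ≤ M + 1 := by
    intro A v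
    have hb : ∀ j, |v j| ≤ M + 1 ↔ |ε * v j| ≤ 1 := fun j => by
      rw [abs_mul, hε, abs_of_pos (one_div_pos.mpr hM), one_div, inv_mul_le_iff₀ hM, mul_one]
    simp only [hb, abs_le', forall_and]
    simp [a, half, ι, Sum.forall, neg_dotProduct]
    tauto
  have hcont : ∀ i : ι, Continuous fun A => a A i := by
    rintro ((i | j) | (i | j))
    · exact continuous_apply i
    · exact continuous_const
    · exact (continuous_apply i).neg
    · exact continuous_const (y := -(Pi.single j ε : Fin m → ℝ))
  let touched : Finset ι → Finset (Fin N) := fun J =>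
    Finset.univ.filter fun i => Sum.inl (Sum.inl i) ∈ J ∨ Sum.inr (Sum.inl i) ∈ J
  have htc : ∀ J, (touched J).card ≤ J.card := fun J => by
    have hsub : touched J ⊆ J.biUnion fun x =>
        Sum.elim (Sum.elim (fun i => {i}) fun _ => ∅) (Sum.elim (fun i => {i}) fun _ => ∅) x := by
      intro i hi
      rw [Finset.mem_biUnion]
      rcases (Finset.mem_filter.mp hi).2 with h | h
      · exact ⟨_, h, by simp⟩
      · exact ⟨_, h, by simp⟩
    refine (Finset.card_le_card hsub).trans ((Finset.card_biUnion_le_card_mul _ _ 1 ?_).trans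
      (mul_one _).le)
    rintro ((i | j) | (i | j)) - <;> simp
  -- an enumeration of each possible active set
  have henum : ∀ J : Finset ι, ∃ e : Fin m → ι, J.card = m → Function.Injective e ∧
      ∀ x, x ∈ J ↔ ∃ k, e k = x := fun J => by
    by_cases hJ : J.card = m
    · refine ⟨fun k => ((J.equivFinOfCardEq hJ).symm k : ι), fun _ =>
        ⟨Subtype.val_injective.comp (Equiv.injective _), fun x => ⟨fun hx =>
        ⟨J.equivFinOfCardEq hJ ⟨x, hx⟩, by simp⟩, ?_⟩⟩⟩
      rintro ⟨k, rfl⟩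
      exact Subtype.mem _
    · rcases Nat.eq_zero_or_pos m with rfl | hm
      · exact ⟨Fin.elim0, fun h => absurd h hJ⟩
      · exact ⟨fun _ => Sum.inl (Sum.inr ⟨0, hm⟩), fun h => absurd h hJ⟩
  choose e he using henum
  let V : Finset ι → (Fin N → Fin m → ℝ) → Fin m → ℝ := fun J A =>
    activeVertex fun k => a A (e J k)
  have hVm : ∀ J, Measurable (V J) := fun J =>
    measurable_activeVertex.comp (measurable_pi_lambda _ fun k => (hcont (e J k)).measurable)
  set G : Set ((Fin m → ℝ) × (Fin m → ℝ)) := {z | |z.2 ⬝ᵥ z.1| ≤ 1} with hG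
  have hGm : MeasurableSet G :=
    (isClosed_le (continuous_snd.dotProduct continuous_fst).abs continuous_const).measurableSet
  have hdep : ∀ J : Finset ι, J.card = m → ∀ A A' : Fin N → Fin m → ℝ,
      (∀ i ∈ touched J, A i = A' i) → V J A = V J A' := by
    intro J hJ A A' hAA
    show activeVertex _ = activeVertex _
    congr 1
    funext k
    have hk : e J k ∈ J := ((he J hJ).2 _).mpr ⟨k, rfl⟩
    rcases hek : e J k with (i | j) | (i | j)
    · exact hAA i (by rw [hek] at hk; simp [touched, hk])
    · rfl
    · rw [hek] at hk
      show -A i = -A' i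
      rw [hAA i (by simp [touched, hk])]
    · rfl
  have hcover : F M ⊆ ⋃ J ∈ (Finset.univ : Finset ι).powersetCard m,
      {A | ρ {x | (V J A, x) ∈ G} ≤ q ∧ ∀ i ∉ touched J, (V J A, A i) ∈ G} := by
    rintro A ⟨w, hw, v₀, h1, h2, h3⟩
    have hbdd : Bornology.IsBounded {v : Fin m → ℝ | ∀ i, a A i ⬝ᵥ v ≤ 1} := by
      refine (Metric.isBounded_closedBall (x := (0 : Fin m → ℝ)) (r := M + 1)).subset fun v hv => ?_
      rw [mem_closedBall_zero_iff, pi_norm_le_iff_of_nonneg hM.le]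
      exact fun j => (((ha A v).mp hv).2 j)
    obtain ⟨v, hv, hwv, g, hg, hli, hgv⟩ :=
      exists_vertex (a A) hbdd w v₀ ((ha A v₀).mpr ⟨h2, h3⟩)
    set J : Finset ι := Finset.univ.image g with hJdef
    have hJ : J.card = m := by
      rw [hJdef, Finset.card_image_of_injective _ hg, Finset.card_univ, Fintype.card_fin]
    obtain ⟨heinj, hemem⟩ := he J hJ
    have hkg : ∀ k, ∃ l, g l = e J k := fun k => by
      have : e J k ∈ J := (hemem _).mpr ⟨k, rfl⟩
      simpa [hJdef] using this
    choose σ hσ using hkg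
    have hσinj : Function.Injective σ := fun k k' hkk =>
      heinj (by rw [← hσ k, ← hσ k', hkk])
    have hvV : v = V J A := by
      refine eq_activeVertex ?_ fun k => ?_
      · have := hli.comp σ hσinj
        convert this using 2 with k
        simp [hσ]
      · rw [← hσ k]; exact hgv _
    refine Set.mem_biUnion (x := J) (by simp [Finset.mem_powersetCard, hJ]) ?_
    rw [Set.mem_ofPred_eq, ← hvV]
    exact ⟨h w hw v (h1.trans hwv), fun i _ => ((ha A v).mp hv).1 i⟩
  calc π (F M) ≤ ∑ J ∈ (Finset.univ : Finset ι).powersetCard m,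
        π {A | ρ {x | (V J A, x) ∈ G} ≤ q ∧ ∀ i ∉ touched J, (V J A, A i) ∈ G} :=
        (measure_mono hcover).trans (measure_biUnion_finset_le _ _)
    _ ≤ ∑ J ∈ (Finset.univ : Finset ι).powersetCard m, q ^ (N - m) := by
        refine Finset.sum_le_sum fun J hJ => ?_
        have hJ : J.card = m := (Finset.mem_powersetCard.mp hJ).2
        refine (measure_pi_forall_notMem_le ρ (touched J) (hVm J) (hdep J hJ) hGm q).trans ?_
        refine pow_le_pow_right_of_le_one' hq ?_
        have := htc J
        rw [Fintype.card_fin]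
        omega
    _ = _ := by
        rw [Finset.sum_const, Finset.card_powersetCard, nsmul_eq_mul]
        congr 3
        simp [ι]
        ring

/-! ### Duality -/

/-- Hahn–Banach criterion for `w` to lie in the image under `B` of the `ℓ₁`-ball of radius `r`. -/
lemma exists_preimage_of_dual {m N : ℕ} (B : Matrix (Fin m) (Fin N) ℝ) (w : Fin m → ℝ) {r : ℝ}
    (hr : 0 ≤ r)
    (h : ∀ v : Fin m → ℝ, 0 < w ⬝ᵥ v → ∃ i, w ⬝ᵥ v ≤ r * |(fun j => B j i) ⬝ᵥ v|) :
    ∃ u : Fin N → ℝ, B.mulVec u = w ∧ ∑ i, |u i| ≤ r := by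
  set U : Set (Fin N → ℝ) := {u | ∑ i, |u i| ≤ r} with hU
  have hUclosed : IsClosed U := isClosed_le (by fun_prop) continuous_const
  have hUb : Bornology.IsBounded U := by
    refine (Metric.isBounded_closedBall (x := (0 : Fin N → ℝ)) (r := r)).subset fun u hu => ?_
    rw [mem_closedBall_zero_iff, pi_norm_le_iff_of_nonneg hr]
    exact fun i => (Finset.single_le_sum (f := fun i => |u i|) (fun i _ => abs_nonneg _)
      (Finset.mem_univ i)).trans hu
  have hUconv : Convex ℝ U := by
    intro x hx y hy a b ha hb hab
    calc ∑ i, |(a • x + b • y) i| ≤ ∑ i, (a * |x i| + b * |y i|) := by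
          refine Finset.sum_le_sum fun i _ => ?_
          simp only [Pi.add_apply, Pi.smul_apply, smul_eq_mul]
          refine (abs_add_le _ _).trans ?_
          rw [abs_mul, abs_mul, abs_of_nonneg ha, abs_of_nonneg hb]
      _ = a * ∑ i, |x i| + b * ∑ i, |y i| := by
          rw [Finset.sum_add_distrib, Finset.mul_sum, Finset.mul_sum]
      _ ≤ a * r + b * r := add_le_add (mul_le_mul_of_nonneg_left hx ha)
          (mul_le_mul_of_nonneg_left hy hb)
      _ = r := by rw [← add_mul, hab, one_mul]
  have hcomp : IsCompact (B.mulVecLin '' U) :=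
    (Metric.isCompact_of_isClosed_isBounded hUclosed hUb).image
      (LinearMap.continuous_of_finiteDimensional _)
  by_contra hno
  have hw : w ∉ B.mulVecLin '' U := by
    rintro ⟨u, hu, huw⟩
    exact hno ⟨u, huw, hu⟩
  obtain ⟨f, c, hf, hc⟩ := geometric_hahn_banach_closed_point
    (hUconv.linear_image B.mulVecLin) hcomp.isClosed hw
  set z : Fin m → ℝ := fun j => f (Pi.single j 1) with hz
  have hfz : ∀ u : Fin m → ℝ, f u = u ⬝ᵥ z := fun u => by
    conv_lhs => rw [pi_eq_sum_univ' u]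
    simp [dotProduct, hz]
  have h0 : 0 < c := by
    have := hf 0 ⟨0, by simp [hU, hr], by simp⟩
    simpa using this
  rw [hfz] at hc
  obtain ⟨i, hi⟩ := h z (h0.trans hc)
  have hcol : ∀ s : ℝ, |s| ≤ r → s * ((fun j => B j i) ⬝ᵥ z) < c := fun s hs => by
    have := hf (B.mulVecLin (Pi.single i s)) ⟨_, by
      simp only [hU, Set.mem_ofPred_eq]
      rw [Finset.sum_eq_single i (fun k _ hk => by simp [Pi.single_eq_of_ne hk]) (by simp)]
      simpa using hs, rfl⟩
    rw [hfz, Matrix.mulVecLin_apply, Matrix.mulVec_single] at this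
    have he : (MulOpposite.op s • B.col i) ⬝ᵥ z = s * ((fun j => B j i) ⬝ᵥ z) := by
      rw [op_smul_eq_smul, smul_dotProduct, smul_eq_mul]
      rfl
    rwa [he] at this
  rcases abs_cases ((fun j => B j i) ⬝ᵥ z) with ⟨ha, -⟩ | ⟨ha, -⟩
  · have := hcol r (abs_of_nonneg hr).le
    rw [ha] at hi
    linarith
  · have := hcol (-r) (by rw [abs_neg, abs_of_nonneg hr])
    rw [ha] at hi
    linarith

/-! ### Numerical estimates -/

lemma one_add_le_log_ratio {m N : ℕ} (hm : 0 < m) {x : ℝ} (hN : Real.exp x * m ≤ N) :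
    1 + x ≤ Real.log (Real.exp 1 * N / m) := by
  have hm' : (0 : ℝ) < m := by exact_mod_cast hm
  have hN' : (0 : ℝ) < N := lt_of_lt_of_le (by positivity) hN
  rw [Real.le_log_iff_exp_le (by positivity), le_div_iff₀ hm', Real.exp_add, mul_assoc]
  exact mul_le_mul_of_nonneg_left hN (Real.exp_pos _).le

lemma choose_mul_pow_le {m N : ℕ} (hm : 0 < m) {p : ℝ} (hp1 : p ≤ 1)
    (hN : Real.exp 22 * m ≤ N)
    (hp : Real.exp (-(Real.log (Real.exp 1 * N / m) / 2)) ≤ p) :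
    ((2 * (N + m)).choose m : ℝ) * (1 - p) ^ (N - m) ≤ Real.exp (-2 * m) := by
  have hm' : (0 : ℝ) < m := by exact_mod_cast hm
  have hN' : (0 : ℝ) < N := lt_of_lt_of_le (by positivity) hN
  have h2 : (2 : ℝ) ≤ Real.exp 22 := by
    have := Real.add_one_le_exp (22 : ℝ); linarith
  have hmN2 : 2 * (m : ℝ) ≤ N := le_trans (by gcongr) hN
  have hmN : m ≤ N := by
    have : (m : ℝ) ≤ N := by linarith
    exact_mod_cast this
  set a := Real.log (Real.exp 1 * N / m) with ha
  have ha23 : 1 + 22 ≤ a := one_add_le_log_ratio hm hN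
  have hexpa : Real.exp a = Real.exp 1 * N / m := Real.exp_log (by positivity)
  -- `choose ≤ (4 e N / m) ^ m`, and `4 ≤ e ^ 2`
  have hchoose : ((2 * (N + m)).choose m : ℝ) ≤ Real.exp (m * (a + 2)) := by
    have hfac : (0 : ℝ) < m.factorial := by exact_mod_cast m.factorial_pos
    have hst : (m : ℝ) ^ m / m.factorial ≤ Real.exp m := Real.pow_div_factorial_le_exp _ hm'.le m
    have h4 : (4 : ℝ) ≤ Real.exp 2 := by
      have := Real.quadratic_le_exp_of_nonneg (x := 2) (by norm_num); norm_num at this; linarith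
    calc ((2 * (N + m)).choose m : ℝ) ≤ ((2 * (N + m) : ℕ) : ℝ) ^ m / m.factorial :=
          Nat.choose_le_pow_div m _
      _ ≤ (4 * N) ^ m / m.factorial := by
          gcongr; push_cast; linarith
      _ = (4 * N / m) ^ m * ((m : ℝ) ^ m / m.factorial) := by
          rw [div_pow]; field_simp
      _ ≤ (4 * N / m) ^ m * Real.exp m := by gcongr
      _ = (4 * (Real.exp 1 * N / m)) ^ m := by
          rw [← Real.exp_one_pow m, ← mul_pow]; congr 1; ring
      _ ≤ (Real.exp 2 * Real.exp a) ^ m := by rw [hexpa]; gcongr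
      _ = Real.exp (m * (a + 2)) := by
          rw [← Real.exp_add, ← Real.exp_nat_mul]; ring_nf
  have hpow : (1 - p) ^ (N - m) ≤ Real.exp (-(p * (N - m))) := by
    calc (1 - p) ^ (N - m) ≤ Real.exp (-p) ^ (N - m) :=
          pow_le_pow_left₀ (by linarith) (by have := Real.add_one_le_exp (-p); linarith) _
      _ = Real.exp (-(p * (N - m))) := by
          rw [← Real.exp_nat_mul, Nat.cast_sub hmN]; ring_nf
  -- `p N ≥ m exp (a / 2 - 1)`, which beats the linear term as `a ≥ 23`
  have hpN : m * (a + 4) ≤ p * (N - m) := by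
    have hNm : (N : ℝ) = m * (Real.exp a * Real.exp (-1)) := by
      rw [hexpa, Real.exp_neg]; field_simp
    have e1 : Real.exp (-(a / 2)) * N = m * Real.exp (a / 2 - 1) := by
      rw [hNm]
      calc _ = m * (Real.exp (-(a / 2)) * (Real.exp a * Real.exp (-1))) := by ring
        _ = _ := by rw [← Real.exp_add, ← Real.exp_add]; ring_nf
    have e2 := Real.quadratic_le_exp_of_nonneg (x := a / 2 - 1) (by linarith)
    have e3 : 2 * (a + 4) ≤ Real.exp (a / 2 - 1) := by nlinarith
    calc m * (a + 4) ≤ m * (Real.exp (a / 2 - 1) / 2) := by gcongr; linarith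
      _ = Real.exp (-(a / 2)) * (N / 2) := by linarith
      _ ≤ p * (N - m) := by
          refine mul_le_mul hp (by linarith) (by positivity) ((Real.exp_pos _).le.trans hp)
  calc ((2 * (N + m)).choose m : ℝ) * (1 - p) ^ (N - m)
      ≤ Real.exp (m * (a + 2)) * Real.exp (-(p * (N - m))) :=
        mul_le_mul hchoose hpow (pow_nonneg (by linarith) _) (Real.exp_pos _).le
    _ = Real.exp (m * (a + 2) - p * (N - m)) := by rw [← Real.exp_add]; ring_nf
    _ ≤ Real.exp (-2 * m) := Real.exp_le_exp.mpr (by linarith)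

/-! ### The quotient property for symmetric product measures -/

lemma sum_sq_eq_l2Norm_sq {m : ℕ} (w : Fin m → ℝ) : ∑ j, w j ^ 2 = l2Norm w ^ 2 := by
  rw [l2Norm, EuclideanSpace.real_norm_sq_eq]

/-- The common core of both parts: the quotient property holds with constants depending only on a
lower bound `b₀` for the second moment of the entries truncated at `L` and, unless the norm
dominates `√(log (e N / m)) ‖·‖_∞`, on a Gaussian lower bound for their tail. -/
theorem exists_quotient_constants {L b₀ c₀ C₀ : ℝ} (hL : 0 ≤ L) (hb₀ : 0 < b₀) (hc₀ : 0 < c₀)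
    (hC₀ : 0 ≤ C₀) :
    ∃ C D : ℝ, 0 < C ∧ 0 < D ∧ ∀ (ν : Measure ℝ) [IsProbabilityMeasure ν],
      MeasurePreserving (fun x : ℝ => -x) ν ν → b₀ ≤ ∫ x in Set.Icc (-L) L, x ^ 2 ∂ν →
      ∀ (m N : ℕ), 0 < m → C * m ≤ N → ∀ nrm : (Fin m → ℝ) → ℝ, (∀ w, l2Norm w ≤ nrm w) →
        ((∀ w j, √(Real.log (Real.exp 1 * N / m)) * |w j| ≤ nrm w) ∨
          ∀ t : ℝ, 1 < t → Real.exp (-(C₀ * t ^ 2)) ≤ ν.real {x | c₀ * t ≤ x}) →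
        Measure.pi (fun _ : Fin N => Measure.pi fun _ : Fin m => ν)
          {A | ¬ HasL1QuotientProperty ((1 / √m) • (Matrix.of A).transpose) D nrm}
          ≤ ENNReal.ofReal (Real.exp (-2 * m)) := by
  set M : ℝ := 3 + L ^ 2 / b₀ with hMdef
  have hM3 : 3 ≤ M := by have : 0 ≤ L ^ 2 / b₀ := by positivity
                         linarith
  set c : ℝ := min (√b₀ / 3) c₀ with hcdef
  have hc : 0 < c := lt_min (by positivity) hc₀
  set C₁ : ℝ := Real.log (8 * M) + C₀ with hC₁def
  have hC₁ : 1 ≤ C₁ := by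
    have : 1 ≤ Real.log (8 * M) := by
      rw [Real.le_log_iff_exp_le (by positivity)]
      have := Real.exp_one_lt_d9
      linarith
    linarith
  have hq₀ : 1 / (8 * M) * Real.exp (-C₀) = Real.exp (-C₁) := by
    rw [hC₁def, neg_add, Real.exp_add, Real.exp_neg (Real.log _), Real.exp_log (by positivity),
      one_div]
  refine ⟨Real.exp (2 * C₁ + 22), 4 * √C₁ / c, Real.exp_pos _, by positivity, ?_⟩
  intro ν _ hν hb m N hm hN nrm hnrm hbig
  have hm' : (0 : ℝ) < m := by exact_mod_cast hm
  set a := Real.log (Real.exp 1 * N / m) with ha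
  have ha1 : 1 + (2 * C₁ + 22) ≤ a := one_add_le_log_ratio hm hN
  have ha0 : 0 < a := by linarith
  -- the number of bins: as large as the target probability `exp (-a / 2)` allows
  set τ := ⌊a / (2 * C₁)⌋₊ with hτdef
  have hτle : (τ : ℝ) ≤ a / (2 * C₁) := Nat.floor_le (by positivity)
  have hτlt : a / (2 * C₁) < τ + 1 := Nat.lt_floor_add_one _
  have hτ1 : 1 ≤ τ := Nat.le_floor (by
    rw [Nat.cast_one, le_div_iff₀ (by positivity)]; linarith)
  have hτ1' : (1 : ℝ) ≤ τ := by exact_mod_cast hτ1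
  have hτa : (τ : ℝ) * C₁ ≤ a / 2 := by
    rw [le_div_iff₀ (by positivity)] at hτle; linarith
  have haτ : a ≤ 4 * C₁ * τ := by
    rw [div_lt_iff₀ (by positivity)] at hτlt
    nlinarith
  set p : ℝ := Real.exp (-C₁) ^ τ with hpdef
  have hp1 : p ≤ 1 := pow_le_one₀ (Real.exp_pos _).le (Real.exp_le_one_iff.mpr (by linarith))
  have hpa : Real.exp (-(a / 2)) ≤ p := by
    rw [hpdef, ← Real.exp_nat_mul]
    exact Real.exp_le_exp.mpr (by linarith)
  set W : Set (Fin m → ℝ) := {w | ∑ j, w j ^ 2 ≤ τ ∧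
    ∀ j, 1 < |w j| → Real.exp (-(C₀ * w j ^ 2)) ≤ ν.real {x | c₀ * |w j| ≤ x}} with hW
  set ρ := Measure.pi fun _ : Fin m => ν with hρ
  have hb' : 0 < ∫ x in Set.Icc (-L) L, x ^ 2 ∂ν := hb₀.trans_le hb
  have hsb : ∀ w ∈ W, ∀ v : Fin m → ℝ, 2 / c ≤ w ⬝ᵥ v →
      ρ {x | |x ⬝ᵥ v| ≤ 1} ≤ ENNReal.ofReal (1 - p) := by
    rintro w ⟨hw1, hw2⟩ v hwv
    have h1 := small_ball hν (c := c) (c₀ := c₀) (C₀ := C₀) (M := M) hL rfl hb' hM3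
      (by
        calc L ^ 2 = L ^ 2 / b₀ * b₀ := by field_simp
          _ ≤ M * ∫ x in Set.Icc (-L) L, x ^ 2 ∂ν :=
            mul_le_mul (by linarith) hb hb₀.le (by linarith)) hτ1 v w hw1 hC₀ hc.le
      (by
        have h1 : c ≤ √b₀ / 3 := min_le_left _ _
        have h2 := Real.sqrt_le_sqrt hb
        linarith) (min_le_right _ _) hw2
    rw [hq₀] at h1
    have hmeas : MeasurableSet {x : Fin m → ℝ | |x ⬝ᵥ v| ≤ 1} :=
      (isClosed_le (continuous_id.dotProduct continuous_const).abs continuous_const).measurableSet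
    have h2 : p ≤ ρ.real {x : Fin m → ℝ | |x ⬝ᵥ v| ≤ 1}ᶜ := by
      refine h1.trans (measureReal_mono fun x hx => ?_)
      have hx : c * (w ⬝ᵥ v) ≤ v ⬝ᵥ x := hx
      rw [div_le_iff₀ hc] at hwv
      rw [dotProduct_comm v x] at hx
      show ¬ |x ⬝ᵥ v| ≤ 1
      intro hcon
      have := (abs_le.mp hcon).2
      linarith
    rw [probReal_compl_eq_one_sub hmeas] at h2
    rw [← ofReal_measureReal]
    exact ENNReal.ofReal_le_ofReal (by linarith)
  have hfail := measure_exists_large_le (N := N) ρ W (2 / c)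
    (q := ENNReal.ofReal (1 - p))
    (ENNReal.ofReal_le_one.mpr (by
      have : 0 < p := by positivity
      linarith)) hsb
  have hnum := choose_mul_pow_le hm hp1 (le_trans (by gcongr; linarith) hN) hpa
  refine (measure_mono ?_).trans (hfail.trans ?_)
  swap
  · rw [← ENNReal.ofReal_pow (by linarith), ← ENNReal.ofReal_natCast, ← ENNReal.ofReal_mul
      (by positivity)]
    exact ENNReal.ofReal_le_ofReal hnum
  -- a matrix without the quotient property has a bad direction `v`
  intro A hA
  have hA : ¬ HasL1QuotientProperty ((1 / √m) • (Matrix.of A).transpose) (4 * √C₁ / c) nrm := hA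
  rw [HasL1QuotientProperty] at hA
  push Not at hA
  obtain ⟨w, hw⟩ := hA
  have hn0 : 0 ≤ nrm w := (norm_nonneg _).trans (hnrm w)
  have hs : √(sStar m N) = √m / √a := by rw [sStar, ← ha, Real.sqrt_div hm'.le]
  rw [hs] at hw
  set r := 4 * √C₁ / c * (√m / √a) * nrm w with hr
  have hr0 : 0 ≤ r := by positivity
  obtain ⟨v, hv0, hv⟩ : ∃ v : Fin m → ℝ, 0 < w ⬝ᵥ v ∧
      ∀ i, r * |(fun j => ((1 / √m) • (Matrix.of A).transpose) j i) ⬝ᵥ v| < w ⬝ᵥ v := by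
    by_contra! hcon
    obtain ⟨u, hu1, hu2⟩ := exists_preimage_of_dual _ w hr0 hcon
    exact absurd hu2 (not_le.mpr (hw u hu1))
  have hnpos : 0 < nrm w := by
    refine lt_of_lt_of_le ?_ (hnrm w)
    rw [l2Norm, norm_pos_iff]
    intro h0
    have : w = 0 := by simpa using h0
    rw [this] at hv0
    simp at hv0
  have hsm : 0 < √(m : ℝ) := Real.sqrt_pos.mpr hm'
  have hsa : 0 < √a := Real.sqrt_pos.mpr ha0
  have hcol : ∀ i, (fun j => ((1 / √(m : ℝ)) • (Matrix.of A).transpose) j i) = (1 / √(m : ℝ)) • A i :=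
    fun i => rfl
  -- rescale so that `‖w‖₂² ≤ τ` and `|⟨A i, v⟩| ≤ 1`; then `⟨w, v⟩ ≥ 2 / c` by the choice of `D`
  refine ⟨(√τ / nrm w) • w, ⟨?_, ?_⟩, (r / √m / (w ⬝ᵥ v)) • v, ?_, fun i => ?_⟩
  · simp only [Pi.smul_apply, smul_eq_mul, mul_pow]
    rw [← Finset.mul_sum, sum_sq_eq_l2Norm_sq, div_pow, Real.sq_sqrt (Nat.cast_nonneg τ),
      div_mul_eq_mul_div, div_le_iff₀ (by positivity)]
    have : 0 ≤ l2Norm w := norm_nonneg _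
    have := hnrm w
    gcongr
  · intro j hj
    rcases hbig with hbig | hbig
    · exfalso
      refine absurd hj (not_lt.mpr ?_)
      have h1 := hbig w j
      have h2 : √(τ : ℝ) ≤ √a := Real.sqrt_le_sqrt (by nlinarith)
      rw [Pi.smul_apply, smul_eq_mul, abs_mul, abs_of_nonneg (by positivity),
        div_mul_eq_mul_div, div_le_one hnpos]
      exact (mul_le_mul_of_nonneg_right h2 (abs_nonneg _)).trans h1
    · have := hbig _ hj
      rwa [sq_abs] at this
  · rw [smul_dotProduct, dotProduct_smul, smul_eq_mul, smul_eq_mul,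
      div_mul_cancel₀ _ hv0.ne', hr]
    have h1 : √a ≤ 2 * √C₁ * √τ := by
      rw [Real.sqrt_le_left (by positivity), mul_pow, mul_pow, Real.sq_sqrt (by linarith),
        Real.sq_sqrt (Nat.cast_nonneg τ)]
      linarith
    calc 2 / c = 2 / c * (√a / √a) := by rw [div_self hsa.ne', mul_one]
      _ ≤ 2 / c * (2 * √C₁ * √τ / √a) := by gcongr
      _ = _ := by field_simp; ring
  · have h1 := hv i
    rw [hcol, smul_dotProduct, smul_eq_mul, abs_mul, abs_of_pos (by positivity)] at h1
    rw [dotProduct_smul, smul_eq_mul, abs_mul, abs_of_nonneg (by positivity),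
      div_mul_eq_mul_div, div_le_one hv0]
    refine le_trans (le_of_eq ?_) h1.le
    ring

/-! ### Passing to the law of the columns -/

lemma map_columns_eq_pi {Ω : Type*} [MeasurableSpace Ω] {μ : Measure Ω} {m N : ℕ}
    {A : Ω → Matrix (Fin m) (Fin N) ℝ} {ν : Measure ℝ} [IsProbabilityMeasure ν]
    (hA : ∀ j i, AEMeasurable (fun ω => A ω j i) μ)
    (hind : iIndepFun (fun (p : Fin m × Fin N) (ω : Ω) => A ω p.1 p.2) μ)
    (hν : ∀ j i, μ.map (fun ω => A ω j i) = ν) :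
    μ.map (fun ω (i : Fin N) (j : Fin m) => A ω j i)
      = Measure.pi fun _ : Fin N => Measure.pi fun _ : Fin m => ν := by
  have h1 := (hind.precomp (g := Prod.swap (α := Fin N) (β := Fin m))
    Prod.swap_injective).map_fun_eq_pi_map fun p => hA _ _
  simp only [Prod.fst_swap, Prod.snd_swap, hν] at h1
  have h2 := Measure.infinitePi_map_curry (fun (_ : Fin N) (_ : Fin m) => ν)
  simp only [Measure.infinitePi_eq_pi] at h2
  rw [← h2, ← h1, AEMeasurable.map_map_of_aemeasurable
    (MeasurableEquiv.measurable _).aemeasurable (aemeasurable_pi_lambda _ fun p => hA _ _)]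
  rfl

lemma ofReal_one_sub_le_measure_of_columns {Ω Ω' : Type*} [MeasurableSpace Ω] [MeasurableSpace Ω']
    {μ : Measure Ω} [IsProbabilityMeasure μ] {P : Measure Ω'} [IsProbabilityMeasure P] {m N : ℕ}
    {A : Ω → Matrix (Fin m) (Fin N) ℝ} {X : Ω' → ℝ} (hA : IsIIDSymmetricUnitVariance A μ X P)
    {ε : ℝ} (hε : 0 ≤ ε) (Q : Matrix (Fin m) (Fin N) ℝ → Prop)
    (h : Measure.pi (fun _ : Fin N => Measure.pi fun _ : Fin m => P.map X)
      {B | ¬ Q (Matrix.of B).transpose} ≤ ENNReal.ofReal ε) :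
    ENNReal.ofReal (1 - 2 * ε) ≤ μ {ω | Q (A ω)} := by
  have : IsProbabilityMeasure (P.map X) :=
    Measure.isProbabilityMeasure_map hA.symmetric.aemeasurable_fst
  have hm : ∀ j i, AEMeasurable (fun ω => A ω j i) μ := fun j i =>
    (hA.identDistrib j i).aemeasurable_fst
  have hmap := map_columns_eq_pi hm hA.indep fun j i => (hA.identDistrib j i).map_eq
  rw [← hmap] at h
  have hbad : μ {ω | ¬ Q (A ω)} ≤ ENNReal.ofReal ε :=
    (Measure.le_map_apply (aemeasurable_pi_lambda _ fun i =>
      aemeasurable_pi_lambda _ fun j => hm j i) _).trans h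
  have h1 : (1 : ENNReal) ≤ μ {ω | Q (A ω)} + ENNReal.ofReal ε := by
    calc (1 : ENNReal) = μ Set.univ := measure_univ.symm
      _ ≤ μ ({ω | Q (A ω)} ∪ {ω | ¬ Q (A ω)}) := measure_mono fun ω _ => em _
      _ ≤ _ := (measure_union_le _ _).trans (add_le_add le_rfl hbad)
  calc ENNReal.ofReal (1 - 2 * ε) ≤ ENNReal.ofReal (1 - ε) :=
        ENNReal.ofReal_le_ofReal (by linarith)
    _ = 1 - ENNReal.ofReal ε := by rw [ENNReal.ofReal_sub _ hε, ENNReal.ofReal_one]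
    _ ≤ _ := tsub_le_iff_right.mpr h1

lemma measurePreserving_neg_map {Ω' : Type*} [MeasurableSpace Ω'] {P : Measure Ω'} {X : Ω' → ℝ}
    (h : IdentDistrib X (fun ω => -X ω) P P) :
    MeasurePreserving (fun x : ℝ => -x) (P.map X) (P.map X) := by
  refine ⟨measurable_neg, ?_⟩
  rw [AEMeasurable.map_map_of_aemeasurable measurable_neg.aemeasurable h.aemeasurable_fst]
  exact h.map_eq.symm

lemma integral_sq_map_eq_one {Ω' : Type*} [MeasurableSpace Ω'] {P : Measure Ω'}
    [IsProbabilityMeasure P] {X : Ω' → ℝ} (hX : AEMeasurable X P) (h0 : ∫ ω, X ω ∂P = 0)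
    (h1 : variance X P = 1) :
    Integrable (fun x : ℝ => x ^ 2) (P.map X) ∧ ∫ x, x ^ 2 ∂(P.map X) = 1 := by
  have hm : AEStronglyMeasurable (fun x : ℝ => x ^ 2) (P.map X) := by fun_prop
  have hL := memLp_two_of_variance_ne_zero hX.aestronglyMeasurable (by rw [h1]; norm_num)
  refine ⟨(integrable_map_measure hm hX).mpr hL.integrable_sq, ?_⟩
  rw [integral_map hX hm, ← variance_of_integral_eq_zero hX h0, h1]

/-! ### Truncated second moments and tails of the entries -/

/-- A bound `K` for the `L₄`-norm makes the contribution of `|x| > 2 K²` to the second moment at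
most `1 / 4`. -/
lemma half_le_truncated_second_moment {ν : Measure ℝ} [IsProbabilityMeasure ν]
    (hi : Integrable (fun x : ℝ => x ^ 2) ν) (h2 : ∫ x, x ^ 2 ∂ν = 1) {K : ℝ} (hK : 0 < K)
    (h4 : eLpNorm (fun x : ℝ => x) (ENNReal.ofReal 4) ν ≤ ENNReal.ofReal K) :
    1 / 2 ≤ ∫ x in Set.Icc (-(2 * K ^ 2)) (2 * K ^ 2), x ^ 2 ∂ν := by
  have hL : MemLp (fun x : ℝ => x) (ENNReal.ofReal 4) ν :=
    ⟨aestronglyMeasurable_id, h4.trans_lt ENNReal.ofReal_lt_top⟩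
  have h4ne : ENNReal.ofReal 4 ≠ 0 := by simp
  rw [hL.eLpNorm_eq_integral_rpow_norm h4ne ENNReal.ofReal_ne_top,
    ENNReal.ofReal_le_ofReal_iff hK.le, ENNReal.toReal_ofReal (by norm_num)] at h4
  have hpow : ∀ x : ℝ, ‖x‖ ^ (4 : ℝ) = x ^ 4 := fun x => by
    rw [show (4 : ℝ) = ((4 : ℕ) : ℝ) by norm_num, Real.rpow_natCast, Real.norm_eq_abs]
    exact Even.pow_abs (by decide) x
  have hi4 : Integrable (fun x : ℝ => x ^ 4) ν := by
    have := hL.integrable_norm_rpow h4ne ENNReal.ofReal_ne_top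
    rw [ENNReal.toReal_ofReal (by norm_num)] at this
    simpa only [hpow] using this
  simp only [hpow] at h4
  have h4' : ∫ x, x ^ 4 ∂ν ≤ K ^ 4 := by
    have hnn : 0 ≤ ∫ x, x ^ 4 ∂ν := integral_nonneg fun x => by positivity
    rw [Real.rpow_inv_le_iff_of_pos hnn hK.le (by norm_num)] at h4
    calc _ ≤ K ^ (4 : ℝ) := h4
      _ = K ^ 4 := by rw [show (4 : ℝ) = ((4 : ℕ) : ℝ) by norm_num, Real.rpow_natCast]
  set I := Set.Icc (-(2 * K ^ 2)) (2 * K ^ 2) with hI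
  have hsplit := integral_add_compl (μ := ν) (measurableSet_Icc : MeasurableSet I) hi
  have htail : ∫ x in Iᶜ, x ^ 2 ∂ν ≤ 1 / (4 * K ^ 4) * ∫ x, x ^ 4 ∂ν := by
    rw [← integral_const_mul]
    calc ∫ x in Iᶜ, x ^ 2 ∂ν ≤ ∫ x in Iᶜ, 1 / (4 * K ^ 4) * x ^ 4 ∂ν := by
          refine setIntegral_mono_on hi.integrableOn (hi4.const_mul _).integrableOn
            measurableSet_Icc.compl fun x hx => ?_
          have hx' : 2 * K ^ 2 < |x| := by
            by_contra! hcon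
            exact hx (abs_le.mp hcon)
          have hx2 : (2 * K ^ 2) ^ 2 ≤ |x| ^ 2 := pow_le_pow_left₀ (by positivity) hx'.le 2
          rw [sq_abs] at hx2
          rw [div_mul_eq_mul_div, one_mul, le_div_iff₀ (by positivity)]
          nlinarith [sq_nonneg x]
      _ ≤ ∫ x, 1 / (4 * K ^ 4) * x ^ 4 ∂ν :=
          setIntegral_le_integral (hi4.const_mul _) (.of_forall fun x => by positivity)
  have : 1 / (4 * K ^ 4) * ∫ x, x ^ 4 ∂ν ≤ 1 / 4 := by
    calc _ ≤ 1 / (4 * K ^ 4) * K ^ 4 := by gcongr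
      _ = 1 / 4 := by field_simp
  linarith

lemma exp_le_gaussianReal_Ioo {t : ℝ} (ht : 0 ≤ t) :
    ENNReal.ofReal (Real.exp (-(1 + (t + 1) ^ 2 / 2))) ≤ gaussianReal 0 1 (Set.Ioo t (t + 1)) := by
  rw [gaussianReal_apply 0 one_ne_zero]
  have hpi : √(2 * Real.pi) ≤ Real.exp 1 := by
    rw [Real.sqrt_le_left (Real.exp_pos _).le]
    have h1 := Real.pi_lt_d2
    have h2 := Real.exp_one_gt_d9
    nlinarith
  calc ENNReal.ofReal (Real.exp (-(1 + (t + 1) ^ 2 / 2)))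
      = ∫⁻ _ in Set.Ioo t (t + 1), ENNReal.ofReal (Real.exp (-(1 + (t + 1) ^ 2 / 2))) := by simp
    _ ≤ ∫⁻ x in Set.Ioo t (t + 1), gaussianPDF 0 1 x := by
        refine setLIntegral_mono (measurable_gaussianPDF 0 1) fun x hx => ?_
        rw [gaussianPDF, gaussianPDFReal]
        refine ENNReal.ofReal_le_ofReal ?_
        simp only [NNReal.coe_one, mul_one, sub_zero]
        rw [neg_add, Real.exp_add, Real.exp_neg 1]
        have hx2 : x ^ 2 ≤ (t + 1) ^ 2 := pow_le_pow_left₀ (ht.trans hx.1.le) hx.2.le 2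
        refine mul_le_mul (inv_anti₀ (by positivity) hpi) (Real.exp_le_exp.mpr (by linarith))
          (Real.exp_pos _).le (by positivity)

lemma exp_le_measureReal_tail {Ω' : Type*} [MeasurableSpace Ω'] {P : Measure Ω'}
    [IsProbabilityMeasure P] {X : Ω' → ℝ} (hX : AEMeasurable X P) {σ : ℝ} (hσ : 0 < σ)
    (h : IsSuperGaussian X P σ) {t : ℝ} (ht : 0 < t) :
    Real.exp (-(1 + (t + 1) ^ 2 / 2)) ≤ (P.map X).real {x | σ * t < |x|} := by
  have hm : MeasurableSet {x : ℝ | σ * t < |x|} :=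
    measurableSet_lt measurable_const measurable_id.abs
  have : IsProbabilityMeasure (P.map X) := Measure.isProbabilityMeasure_map hX
  have h1 : ENNReal.ofReal (Real.exp (-(1 + (t + 1) ^ 2 / 2)))
      ≤ P.map X {x | σ * t < |x|} := by
    refine (exp_le_gaussianReal_Ioo ht.le).trans ((measure_mono fun x hx => ?_).trans
      ((h.tail (σ * t) (by positivity)).trans (Measure.map_apply_of_aemeasurable hX hm).ge))
    show σ * t < |σ * x|
    rw [abs_of_pos (mul_pos hσ (ht.trans hx.1))]
    exact mul_lt_mul_of_pos_left hx.1 hσ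
  rwa [← ofReal_measureReal, ENNReal.ofReal_le_ofReal_iff measureReal_nonneg] at h1

/-- Values in `(δ, L]` contribute at least `δ²` times their probability, and values beyond `L` are
removed by Chebyshev's inequality. -/
lemma truncated_second_moment_of_tail {ν : Measure ℝ} [IsProbabilityMeasure ν]
    (hi : Integrable (fun x : ℝ => x ^ 2) ν) (h2 : ∫ x, x ^ 2 ∂ν = 1) {δ L : ℝ} (hδ : 0 ≤ δ)
    (hL : 0 < L) :
    δ ^ 2 * (ν.real {x | δ < |x|} - 1 / L ^ 2) ≤ ∫ x in Set.Icc (-L) L, x ^ 2 ∂ν := by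
  have hcheb : ν.real {x | L < |x|} ≤ 1 / L ^ 2 := by
    have h := mul_meas_ge_le_integral_of_nonneg (μ := ν) (.of_forall fun x => sq_nonneg x) hi (L ^ 2)
    rw [h2] at h
    rw [le_div_iff₀ (by positivity), mul_comm]
    refine le_trans (mul_le_mul_of_nonneg_left (measureReal_mono fun x hx => ?_) (by positivity)) h
    have hx : L < |x| := hx
    show L ^ 2 ≤ x ^ 2
    rw [← sq_abs x]
    exact pow_le_pow_left₀ hL.le hx.le 2
  set T := {x : ℝ | δ < |x|} ∩ Set.Icc (-L) L with hT
  have hTm : MeasurableSet T :=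
    (measurableSet_lt measurable_const measurable_id.abs).inter measurableSet_Icc
  have hsub : ν.real {x | δ < |x|} ≤ ν.real T + 1 / L ^ 2 := by
    refine le_trans (measureReal_mono fun x hx => ?_) ((measureReal_union_le T {x | L < |x|}).trans
      (add_le_add le_rfl hcheb))
    rcases le_or_gt |x| L with hxL | hxL
    · exact Or.inl ⟨hx, abs_le.mp hxL⟩
    · exact Or.inr hxL
  calc δ ^ 2 * (ν.real {x | δ < |x|} - 1 / L ^ 2) ≤ δ ^ 2 * ν.real T :=
        mul_le_mul_of_nonneg_left (by linarith) (sq_nonneg _)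
    _ = ∫ _ in T, δ ^ 2 ∂ν := by rw [setIntegral_const, smul_eq_mul, mul_comm]
    _ ≤ ∫ x in T, x ^ 2 ∂ν := by
        refine setIntegral_mono_on (integrable_const _).integrableOn hi.integrableOn hTm
          fun x hx => ?_
        rw [← sq_abs x]
        exact pow_le_pow_left₀ hδ (le_of_lt hx.1) 2
    _ ≤ ∫ x in Set.Icc (-L) L, x ^ 2 ∂ν :=
        setIntegral_mono_set hi.integrableOn (.of_forall fun x => sq_nonneg x)
          (Set.inter_subset_right.eventuallyLE)

lemma measureReal_abs_gt_le_two_mul {ν : Measure ℝ} [IsFiniteMeasure ν]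
    (hν : MeasurePreserving (fun x : ℝ => -x) ν ν) (r : ℝ) :
    ν.real {x | r < |x|} ≤ 2 * ν.real {x | r ≤ x} :=
  measureReal_le_two_mul_of_subset_union_preimage hν measurableSet_Ici fun x hx => by
    rcases lt_abs.mp (show r < |x| from hx) with h | h
    · exact Or.inl h.le
    · exact Or.inr (show r ≤ -x from h.le)

/-! ### The two quotient properties -/

theorem theorem2p3 :
    -- (a) weak moment assumption, clipped norm
    (∃ c₀ : ℝ, 0 < c₀ ∧
      ∀ κ γ : ℝ, 0 < κ → 1 / 2 ≤ γ →
        ∃ C D : ℝ, 0 < C ∧ 0 < D ∧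
          ∀ (m N : ℕ) (Ω Ω' : Type*) [MeasurableSpace Ω] [MeasurableSpace Ω']
            (μ : Measure Ω) [IsProbabilityMeasure μ] (P : Measure Ω') [IsProbabilityMeasure P]
            (A : Ω → Matrix (Fin m) (Fin N) ℝ) (X : Ω' → ℝ),
            0 < m →
            IsIIDSymmetricUnitVariance A μ X P →
            WeakMomentAssumption X P (max 4 (Real.log m)) κ γ →
            4 * Real.exp (4 * γ) * c₀ ^ 2 * κ ^ 2 * Real.log m ≤ m →
            max (C * m) (Real.log m ^ (2 * γ - 1)) ≤ (N : ℝ) →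
            ENNReal.ofReal (1 - 2 * Real.exp (-2 * m)) ≤
              μ {ω | HasL1QuotientProperty ((1 / Real.sqrt m) • A ω) D
                (clippedNorm (Real.sqrt (Real.log (Real.exp 1 * N / m))))}) ∧
    -- (b) super-Gaussian entries, Euclidean norm
    (∀ σ : ℝ, 0 < σ → σ ≤ 1 →
      ∃ C D : ℝ, 0 < C ∧ 0 < D ∧
        ∀ (m N : ℕ) (Ω Ω' : Type*) [MeasurableSpace Ω] [MeasurableSpace Ω']
          (μ : Measure Ω) [IsProbabilityMeasure μ] (P : Measure Ω') [IsProbabilityMeasure P]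
          (A : Ω → Matrix (Fin m) (Fin N) ℝ) (X : Ω' → ℝ),
          0 < m →
          IsIIDSymmetricUnitVariance A μ X P →
          IsSuperGaussian X P σ →
          C * m ≤ (N : ℝ) →
          ENNReal.ofReal (1 - 2 * Real.exp (-2 * m)) ≤
            μ {ω | HasL1QuotientProperty ((1 / Real.sqrt m) • A ω) D l2Norm}) := by
  constructor
  · refine ⟨1, one_pos, fun κ γ hκ _ => ?_⟩
    set K : ℝ := κ * 4 ^ γ with hK
    have hK0 : 0 < K := by positivity
    obtain ⟨C, D, hC, hD, h⟩ := exists_quotient_constants (L := 2 * K ^ 2) (b₀ := 1 / 2)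
      (c₀ := 1) (C₀ := 0) (by positivity) (by norm_num) one_pos le_rfl
    refine ⟨C, D, hC, hD, ?_⟩
    intro m N Ω Ω' _ _ μ _ P _ A X hm hA hX _ hN
    have hXm := hA.symmetric.aemeasurable_fst
    have : IsProbabilityMeasure (P.map X) := Measure.isProbabilityMeasure_map hXm
    obtain ⟨hi, h2⟩ := integral_sq_map_eq_one hXm hX.mean_zero hX.variance_one
    have h4 : eLpNorm (fun x : ℝ => x) (ENNReal.ofReal 4) (P.map X) ≤ ENNReal.ofReal K := by
      change eLpNorm id _ _ ≤ _
      rw [eLpNorm_map_measure aestronglyMeasurable_id hXm]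
      exact hX.moment 4 le_rfl (le_max_left _ _)
    refine ofReal_one_sub_le_measure_of_columns hA (Real.exp_pos _).le
      (fun B => HasL1QuotientProperty ((1 / √m) • B) D
        (clippedNorm (√(Real.log (Real.exp 1 * N / m))))) ?_
    refine h (P.map X) (measurePreserving_neg_map hA.symmetric)
      (half_le_truncated_second_moment hi h2 hK0 h4) m N hm ((le_max_left _ _).trans hN) _
      (fun w => le_max_left _ _) (Or.inl fun w j => ?_)
    refine le_trans (mul_le_mul_of_nonneg_left ?_ (Real.sqrt_nonneg _)) (le_max_right _ _)
    exact norm_le_pi_norm w j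
  · intro σ hσ _
    obtain ⟨C, D, hC, hD, h⟩ := exists_quotient_constants (L := Real.exp 2)
      (b₀ := σ ^ 2 * Real.exp (-4)) (c₀ := σ) (C₀ := 4) (Real.exp_pos _).le (by positivity) hσ
      (by norm_num)
    refine ⟨C, D, hC, hD, ?_⟩
    intro m N Ω Ω' _ _ μ _ P _ A X hm hA hX hN
    have hXm := hA.symmetric.aemeasurable_fst
    have : IsProbabilityMeasure (P.map X) := Measure.isProbabilityMeasure_map hXm
    obtain ⟨hi, h2⟩ := integral_sq_map_eq_one hXm hX.mean_zero hX.variance_one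
    have hν := measurePreserving_neg_map hA.symmetric
    have he2 : (2 : ℝ) ≤ Real.exp 1 := by
      have := Real.add_one_le_exp (1 : ℝ); linarith
    refine ofReal_one_sub_le_measure_of_columns hA (Real.exp_pos _).le
      (fun B => HasL1QuotientProperty ((1 / √m) • B) D l2Norm) ?_
    refine h (P.map X) hν ?_ m N hm hN _ (fun w => le_rfl) (Or.inr fun t ht => ?_)
    · refine le_trans ?_ (truncated_second_moment_of_tail hi h2 hσ.le (Real.exp_pos 2))
      refine mul_le_mul_of_nonneg_left ?_ (sq_nonneg _)
      have h3 := exp_le_measureReal_tail hXm hσ hX one_pos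
      rw [mul_one] at h3
      have e1 : Real.exp (-(1 + (1 + 1) ^ 2 / 2)) = Real.exp 1 * Real.exp (-4) := by
        rw [← Real.exp_add]; norm_num
      have e2 : 1 / Real.exp 2 ^ 2 = Real.exp (-4) := by
        rw [← Real.exp_nat_mul, one_div, ← Real.exp_neg]; norm_num
      rw [e1] at h3
      rw [e2]
      nlinarith [Real.exp_pos (-4)]
    · have h3 := exp_le_measureReal_tail hXm hσ hX (by linarith : 0 < t)
      have h4 := measureReal_abs_gt_le_two_mul hν (σ * t)
      have h5 : 2 * Real.exp (-(4 * t ^ 2)) ≤ Real.exp (-(1 + (t + 1) ^ 2 / 2)) := by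
        calc 2 * Real.exp (-(4 * t ^ 2)) ≤ Real.exp 1 * Real.exp (-(4 * t ^ 2)) := by gcongr
          _ = Real.exp (1 + -(4 * t ^ 2)) := (Real.exp_add _ _).symm
          _ ≤ _ := Real.exp_le_exp.mpr (by nlinarith)
      linarith
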